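/- **Conventions.** For positive integers $a,b,c$ let $\mathcal H_A=\mathbb C^a$, $\mathcal H_B=\mathbb C^b$, $\mathcal H_C=\mathbb C^c$, and let $M_A,M_B,M_C$ be the algebras of $a\times a$, $b\times b$, $c\times c$ complex matrices. An operator system $\mathcal S$ has a unit $1_{\mathcal S}$ and positive cones $M_n(\mathcal S)^+$, $n\ge 1$, with $\mathcal S^+=M_1(\mathcal S)^+$; matrix algebras carry their usual structure, in which an element of $M_n(M_d)=M_{nd}$ is positive if it is positive semidefinite. For an operator system $\mathcal S$ and $k\ge 1$, $\mathrm{OMAX}^k(\mathcal S)$ is the space $\mathcal S$ with the same unit and with the cones $$M_n(\mathrm{OMAX}^k(\mathcal S))^+=\{x : \forall \varepsilon>0,\ x+\varepsilon I_n\otimes 1_{\mathcal S}\in D_n^{\max,k}(\mathcal S)\},$$ $$D_n^{\max,k}(\mathcal S)=\{\alpha\,\mathrm{diag}(s_1,\dots,s_m)\,\alpha^* : m\ge 1,\ s_i\in M_k(\mathcal S)^+,\ \alpha\in M_{n,mk}(\mathbb C)\}.$$ The maximal tensor product $\mathcal S\otimes_{\max}\mathcal T$ is the space $\mathcal S\otimes\mathcal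 T$ with unit $1_{\mathcal S}\otimes 1_{\mathcal T}$ and with the cones $$M_n(\mathcal S\otimes_{\max}\mathcal T)^+=\{z : \forall\varepsilon>0,\ z+\varepsilon I_n\otimes 1_{\mathcal S}\otimes 1_{\mathcal T}\in D_n^{\max}(\mathcal S,\mathcal T)\},$$ $$D_n^{\max}(\mathcal S,\mathcal T)=\{\alpha(P\otimes Q)\alpha^* : k,\ell\ge 1,\ P\in M_k(\mathcal S)^+,\ Q\in M_\ell(\mathcal T)^+,\ \alpha\in M_{n,k\ell}(\mathbb C)\}.$$ Multiple maximal tensor products are iterated, bracketed to the right. The isomorphism $\mathcal H_A\otimes\mathcal H_B\otimes\mathcal H_C\simeq\mathcal L(\mathcal H_A,\mathcal L(\mathcal H_B,\mathcal H_C))$, $\xi\mapsto\Lambda_\xi$, is the linear one for which $\Lambda_{u\otimes v\otimes w}(x)(y)=\big(\sum_i u_ix_i\big)\big(\sum_j v_jy_j\big)\,w$. Writing $\mathrm{supp}\,T=(\ker T)^\perp$, the Schmidt rank $\mathrm{SR}(\xi)=(\alpha_\xi,\beta_\xi,\gamma_\xi)$ is $$\alpha_\xi=\mathrm{rank}\,\Lambda_\xi,\qquad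 \beta_\xi=\dim\bigvee\{\mathrm{supp}\,T: T\in\mathrm{ran}\,\Lambda_\xi\},\qquad \gamma_\xi=\dim\bigvee\{\mathrm{ran}\,T: T\in\mathrm{ran}\,\Lambda_\xi\},$$ and $\mathrm{SR}(\xi)\le(p,q,r)$ means $\alpha_\xi\le p$, $\beta_\xi\le q$, $\gamma_\xi\le r$. For positive integers $p,q,r$, $\mathbb S_{p,q,r}\subset M_A\otimes M_B\otimes M_C$ is the set of all finite sums $\sum_i|\xi_i\rangle\langle\xi_i|$ with $\xi_i\in\mathcal H_A\otimes\mathcal H_B\otimes\mathcal H_C$ and $\mathrm{SR}(\xi_i)\le(p,q,r)$ for all $i$. Let $\Omega\subset M_A\otimes M_B\otimes M_C$ be the set of all elements $$\Theta\big(\mathrm{diag}(X_1,\dots,X_s)\otimes\mathrm{diag}(Y_1,\dots,Y_t)\otimes\mathrm{diag}(Z_1,\dots,Z_u)\big)\Theta^*$$ with $s,t,u\ge 1$, $X_i\in M_p(M_A)^+$, $Y_j\in M_q(M_B)^+$, $Z_k\in M_r(M_C)^+$ and $\Theta\in M_{1,pqrstu}(\mathbb C)$. **Theorem.** Let $p,q,r$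 be positive integers. (1) An element $\varrho\in M_A\otimes M_B\otimes M_C$ belongs to $\mathbb S_{p,q,r}$ if and only if $$\varrho\in[\mathrm{OMAX}^p(M_A)\otimes_{\max}\mathrm{OMAX}^q(M_B)\otimes_{\max}\mathrm{OMAX}^r(M_C)]^+ .$$ (2) $\Omega=[\mathrm{OMAX}^p(M_A)\otimes_{\max}\mathrm{OMAX}^q(M_B)\otimes_{\max}\mathrm{OMAX}^r(M_C)]^+$. (3) Let $n\ge 1$, let $\mathcal H_i=\mathbb C^{d_i}$ with positive integers $d_1,\dots,d_n$, and let $s_1,\dots,s_n$ be positive integers. Let $\xi\mapsto\Lambda_\xi$ be the analogous isomorphism $\mathcal H_1\otimes\cdots\otimes\mathcal H_n\simeq\mathcal L(\mathcal H_1,\mathcal L(\mathcal H_2,\dots,\mathcal L(\mathcal H_{n-1},\mathcal H_n)))$ (the identity if $n=1$). Put $K_1=\{\Lambda_\xi\}$, $K_{i+1}=\bigcup_{T\in K_i}\mathrm{ran}\,T$, $\alpha^i_\xi=\dim\bigvee\{\mathrm{supp}\,T:T\in K_i\}$ for $1\le i<n$, and $\alpha^n_\xi=\dim\mathrm{span}\,K_n$.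 Let $\mathbb S_{s_1,\dots,s_n}$ be the set of all finite sums $\sum_i|\xi_i\rangle\langle\xi_i|$ with $\alpha^j_{\xi_i}\le s_j$ for all $i$ and $j$. Then $$\mathbb S_{s_1,\dots,s_n}=[\mathrm{OMAX}^{s_1}(\mathcal L(\mathcal H_1))\otimes_{\max}\cdots\otimes_{\max}\mathrm{OMAX}^{s_n}(\mathcal L(\mathcal H_n))]^+ .$$ -/

import Mathlib

open scoped TensorProduct ComplexOrder

noncomputable section

namespace SchmidtNumber

/-! ### Operator system data and the two constructions `OMAX^k` and `⊗_max` -/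

/-- The data of an operator system structure on a complex vector space `V`: the unit `1_V` and,
for every `n`, the positive cone `M_n(V)⁺` inside the `n × n` matrices over `V`.  All the instances
used below are built explicitly. -/
structure MatrixOrder (V : Type*) where
  /-- the (Archimedean matrix) order unit -/
  unit : V
  /-- the positive cones `M_n(V)⁺` -/
  pos : (n : ℕ) → Set (Matrix (Fin n) (Fin n) V)

/-- `α X α*` for a scalar matrix `α` and a square matrix `X` over a complex vector space. -/
def conj {V : Type*} [AddCommGroup V] [Module ℂ V] {ι κ : Type*} [Fintype κ]
    (α : Matrix ι κ ℂ) (X : Matrix κ κ V) : Matrix ι ι V :=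
  Matrix.of fun i j => ∑ k, ∑ l, (α i k * star (α j l)) • X k l

/-- The tensor product `X ⊗ Y` of a matrix over `V` and a matrix over `W`, as a matrix
over `V ⊗ W`. -/
def tmulMatrix {V W : Type*} [AddCommGroup V] [Module ℂ V] [AddCommGroup W] [Module ℂ W]
    {ι κ : Type*} (X : Matrix ι ι V) (Y : Matrix κ κ W) : Matrix (ι × κ) (ι × κ) (V ⊗[ℂ] W) :=
  Matrix.of fun i j => X i.1 j.1 ⊗ₜ[ℂ] Y i.2 j.2

/-- An element of `V` seen as a `1 × 1` matrix over `V`. -/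
def oneByOne {V : Type*} (x : V) : Matrix (Fin 1) (Fin 1) V :=
  Matrix.of fun _ _ => x

namespace MatrixOrder

variable {V W : Type*} [AddCommGroup V] [Module ℂ V] [AddCommGroup W] [Module ℂ W]

/-- The positive cone `V⁺ = M_1(V)⁺` of the space itself. -/
def posCone {V : Type*} (S : MatrixOrder V) : Set V :=
  {x | oneByOne x ∈ S.pos 1}

/-- Archimedeanization of a family `D` of cones with respect to the unit `e`: the matrices `x` with
`x + ε (I_n ⊗ e) ∈ D_n` for every real `ε > 0`. -/
def archimedeanization (e : V) (D : (n : ℕ) → Set (Matrix (Fin n) (Fin n) V)) :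
    MatrixOrder V where
  unit := e
  pos n := {x | ∀ ε : ℝ, 0 < ε → x + (ε : ℂ) • Matrix.diagonal (fun _ : Fin n => e) ∈ D n}

/-- The set `D_n^{max,k}(S)` of all matrices `α diag(s₁, …, s_m) α*` with `m ≥ 1`, `s_i ∈ M_k(S)⁺`
and `α` an `n × mk` scalar matrix. -/
def omaxCone (k : ℕ) (S : MatrixOrder V) (n : ℕ) : Set (Matrix (Fin n) (Fin n) V) :=
  {x | ∃ m : ℕ, 0 < m ∧ ∃ s : Fin m → Matrix (Fin k) (Fin k) V, (∀ i, s i ∈ S.pos k) ∧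
    ∃ α : Matrix (Fin n) (Fin k × Fin m) ℂ, x = conj α (Matrix.blockDiagonal s)}

/-- The super `k`-maximal operator system `OMAX^k(S)`. -/
def omax (k : ℕ) (S : MatrixOrder V) : MatrixOrder V :=
  archimedeanization S.unit (omaxCone k S)

/-- The set `D_n^max(S, T)` of all matrices `α (P ⊗ Q) α*` with `P ∈ M_k(S)⁺`, `Q ∈ M_l(T)⁺` and
`α` an `n × kl` scalar matrix. -/
def maxCone (S : MatrixOrder V) (T : MatrixOrder W) (n : ℕ) :
    Set (Matrix (Fin n) (Fin n) (V ⊗[ℂ] W)) :=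
  {x | ∃ k l : ℕ, 0 < k ∧ 0 < l ∧ ∃ P ∈ S.pos k, ∃ Q ∈ T.pos l,
    ∃ α : Matrix (Fin n) (Fin k × Fin l) ℂ, x = conj α (tmulMatrix P Q)}

/-- The maximal tensor product `S ⊗_max T` of operator systems. -/
def maxTensor (S : MatrixOrder V) (T : MatrixOrder W) : MatrixOrder (V ⊗[ℂ] W) :=
  archimedeanization (S.unit ⊗ₜ[ℂ] T.unit) (maxCone S T)

end MatrixOrder

/-! ### Matrix algebras and their tensor products -/

/-- The Hilbert space `ℂ^d`. -/
abbrev Hil (d : ℕ) : Type := EuclideanSpace ℂ (Fin d)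

/-- The algebra of `d × d` complex matrices. -/
abbrev Mat (d : ℕ) : Type := Matrix (Fin d) (Fin d) ℂ

/-- The matrix algebra `M_d` with its usual operator system structure: a matrix over `M_d` is
positive if, read as an `nd × nd` complex matrix, it is positive semidefinite. -/
def matAlg (d : ℕ) : MatrixOrder (Mat d) where
  unit := 1
  pos n := {X | (Matrix.comp (Fin n) (Fin n) (Fin d) (Fin d) ℂ X).PosSemidef}

/-- The rank one operator `|u⟩⟨v|` on `ℂ^d`, linear in `u` and conjugate linear in `v`. -/
def ketBra (d : ℕ) : Hil d →ₗ[ℂ] Hil d →ₛₗ[starRingEnd ℂ] Mat d :=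
  LinearMap.mk₂'ₛₗ (RingHom.id ℂ) (starRingEnd ℂ)
    (fun u v => Matrix.of fun i j => u i * star (v j))
    (fun u u' v => by ext i j; simp [add_mul])
    (fun c u v => by ext i j; simp [mul_assoc])
    (fun u v v' => by ext i j; simp [mul_add])
    (fun c u v => by ext i j; simp [mul_left_comm])

/-- The bilinear form `(u, v) ↦ ⟨ū | v⟩ = ∑ i, u i * v i` on `ℂ^d`. -/
def dot (d : ℕ) : Hil d →ₗ[ℂ] Hil d →ₗ[ℂ] ℂ :=
  LinearMap.mk₂ ℂ (fun u v => ∑ i, u i * v i)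
    (fun u u' v => by simp [add_mul, Finset.sum_add_distrib])
    (fun c u v => by simp [mul_assoc, Finset.mul_sum])
    (fun u v v' => by simp [mul_add, Finset.sum_add_distrib])
    (fun c u v => by simp [mul_left_comm, Finset.mul_sum])

/-- The canonical isomorphism `ℂ^d ⊗ W ≃ (ℂ^d)* ⊗ W ≃ L(ℂ^d, W)`, which sends `u ⊗ w` to
`v ↦ ⟨ū | v⟩ w`. -/
def toHom (d : ℕ) (W : Type*) [AddCommGroup W] [Module ℂ W] :
    Hil d ⊗[ℂ] W →ₗ[ℂ] (Hil d →ₗ[ℂ] W) :=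
  TensorProduct.lift ((LinearMap.smulRightₗ (R := ℂ) (M := W) (M₂ := Hil d)) ∘ₗ dot d)

/-! ### Schmidt numbers of tri-partite states -/

section Tripartite

/-- `H_A ⊗ H_B ⊗ H_C` -/
abbrev Hil₃ (a b c : ℕ) : Type := Hil a ⊗[ℂ] (Hil b ⊗[ℂ] Hil c)

/-- `M_A ⊗ M_B ⊗ M_C` -/
abbrev Mat₃ (a b c : ℕ) : Type := Mat a ⊗[ℂ] (Mat b ⊗[ℂ] Mat c)

variable {a b c : ℕ}

/-- `|ξ⟩⟨ξ|` as an element of `M_A ⊗ M_B ⊗ M_C`. -/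
def proj₃ (ξ : Hil₃ a b c) : Mat₃ a b c :=
  TensorProduct.map₂ (ketBra a) (TensorProduct.map₂ (ketBra b) (ketBra c)) ξ ξ

/-- The linear map `Λ_ξ : H_A → L(H_B, H_C)` associated with `ξ`. -/
def assocMap₃ (ξ : Hil₃ a b c) : Hil a →ₗ[ℂ] (Hil b →ₗ[ℂ] Hil c) :=
  toHom a (Hil b →ₗ[ℂ] Hil c) (TensorProduct.map LinearMap.id (toHom b (Hil c)) ξ)

/-- `α_ξ`, the rank of `Λ_ξ`. -/
def rankA (ξ : Hil₃ a b c) : ℕ :=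
  Module.finrank ℂ (LinearMap.range (assocMap₃ ξ))

/-- `β_ξ`, the dimension of the join of the supports (orthogonal complements of the kernels) of
the maps in the range of `Λ_ξ`. -/
def rankB (ξ : Hil₃ a b c) : ℕ :=
  Module.finrank ℂ ↥(⨆ T ∈ LinearMap.range (assocMap₃ ξ), (LinearMap.ker T)ᗮ)

/-- `γ_ξ`, the dimension of the join of the ranges of the maps in the range of `Λ_ξ`. -/
def rankC (ξ : Hil₃ a b c) : ℕ :=
  Module.finrank ℂ ↥(⨆ T ∈ LinearMap.range (assocMap₃ ξ), LinearMap.range T)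

/-- The set `𝕊_{p,q,r}` of all finite sums `∑ |ξ_i⟩⟨ξ_i|` with `SR(ξ_i) ≤ (p, q, r)`. -/
def schmidtCone₃ (a b c p q r : ℕ) : Set (Mat₃ a b c) :=
  {ρ | ∃ (N : ℕ) (ξ : Fin N → Hil₃ a b c),
    (∀ i, rankA (ξ i) ≤ p ∧ rankB (ξ i) ≤ q ∧ rankC (ξ i) ≤ r) ∧ ρ = ∑ i, proj₃ (ξ i)}

/-- The operator system `OMAX^p(M_A) ⊗_max OMAX^q(M_B) ⊗_max OMAX^r(M_C)`. -/
def omaxTensor₃ (a b c p q r : ℕ) : MatrixOrder (Mat₃ a b c) :=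
  ((matAlg a).omax p).maxTensor (((matAlg b).omax q).maxTensor ((matAlg c).omax r))

/-- The set `Ω` of all `Θ (diag(X₁,…,X_s) ⊗ diag(Y₁,…,Y_t) ⊗ diag(Z₁,…,Z_u)) Θ*` with
`s, t, u ≥ 1`, `X_i ∈ M_p(M_A)⁺`, `Y_j ∈ M_q(M_B)⁺`, `Z_k ∈ M_r(M_C)⁺` and `Θ` a scalar row of
length `pqrstu`. -/
def omegaSet (a b c p q r : ℕ) : Set (Mat₃ a b c) :=
  {ρ | ∃ s t u : ℕ, 0 < s ∧ 0 < t ∧ 0 < u ∧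
    ∃ X : Fin s → Matrix (Fin p) (Fin p) (Mat a), (∀ i, X i ∈ (matAlg a).pos p) ∧
    ∃ Y : Fin t → Matrix (Fin q) (Fin q) (Mat b), (∀ j, Y j ∈ (matAlg b).pos q) ∧
    ∃ Z : Fin u → Matrix (Fin r) (Fin r) (Mat c), (∀ k, Z k ∈ (matAlg c).pos r) ∧
    ∃ Θ : Matrix (Fin 1) ((Fin p × Fin s) × ((Fin q × Fin t) × (Fin r × Fin u))) ℂ,
      oneByOne ρ = conj Θ (tmulMatrix (Matrix.blockDiagonal X)
        (tmulMatrix (Matrix.blockDiagonal Y) (Matrix.blockDiagonal Z)))}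

end Tripartite

/-! ### Schmidt numbers of multi-partite states

The parties are numbered by `Fin (n + 1)`; `d i` is the dimension of the `i`-th Hilbert space.
Tensor products and spaces of maps are nested to the right; they are bundled as `ModuleCat`
objects only so that the recursion carries the vector space structure. -/

section Multipartite

/-- `H_0 ⊗ (H_1 ⊗ (⋯ ⊗ H_n))` -/
def HilN : (n : ℕ) → (Fin (n + 1) → ℕ) → ModuleCat.{0} ℂ
  | 0, d => ModuleCat.of ℂ (Hil (d 0))
  | n + 1, d => ModuleCat.of ℂ (Hil (d 0) ⊗[ℂ] HilN n (Fin.tail d))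

/-- `L(H_0) ⊗ (L(H_1) ⊗ (⋯ ⊗ L(H_n)))`, where `L(H_i)` is the algebra of `d i × d i` matrices. -/
def MatN : (n : ℕ) → (Fin (n + 1) → ℕ) → ModuleCat.{0} ℂ
  | 0, d => ModuleCat.of ℂ (Mat (d 0))
  | n + 1, d => ModuleCat.of ℂ (Mat (d 0) ⊗[ℂ] MatN n (Fin.tail d))

/-- `L(H_0, L(H_1, …, L(H_{n-1}, H_n)))` -/
def HomN : (n : ℕ) → (Fin (n + 1) → ℕ) → ModuleCat.{0} ℂ
  | 0, d => ModuleCat.of ℂ (Hil (d 0))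
  | n + 1, d => ModuleCat.of ℂ (Hil (d 0) →ₗ[ℂ] HomN n (Fin.tail d))

/-- `(ξ, η) ↦ |ξ⟩⟨η|`, linear in `ξ` and conjugate linear in `η`. -/
def ketBraN : (n : ℕ) → (d : Fin (n + 1) → ℕ) →
    (HilN n d →ₗ[ℂ] HilN n d →ₛₗ[starRingEnd ℂ] MatN n d)
  | 0, d => ketBra (d 0)
  | n + 1, d => TensorProduct.map₂ (ketBra (d 0)) (ketBraN n (Fin.tail d))

/-- The map `ξ ↦ Λ_ξ`. -/
def assocMapN : (n : ℕ) → (d : Fin (n + 1) → ℕ) → (HilN n d →ₗ[ℂ] HomN n d)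
  | 0, _ => LinearMap.id
  | n + 1, d => toHom (d 0) (HomN n (Fin.tail d)) ∘ₗ
      TensorProduct.map LinearMap.id (assocMapN n (Fin.tail d))

/-- For a set `K` of elements of `L(H_0, L(H_1, …, H_n))`: the first number is the dimension of the
join of the supports of the maps `T ∈ K`; the next numbers are obtained in the same way from the set
of all elements of the ranges of the maps `T ∈ K`.  When only the last space `H_n` is left, the
number is the dimension of the span of the vectors reached, that is, of the join of the ranges of
the last maps. -/
def joinRanks : (n : ℕ) → (d : Fin (n + 1) → ℕ) → Set (HomN n d) → Fin (n + 1) → ℕ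
  | 0, d, K => fun _ => Module.finrank ℂ (Submodule.span ℂ (show Set (Hil (d 0)) from K))
  | n + 1, d, K =>
      let K' : Set (Hil (d 0) →ₗ[ℂ] HomN n (Fin.tail d)) := K
      Fin.cons (α := fun _ => ℕ) (Module.finrank ℂ ↥(⨆ T ∈ K', (LinearMap.ker T)ᗮ))
        (joinRanks n (Fin.tail d) (⋃ T ∈ K', Set.range T))

/-- The Schmidt rank `SR(ξ) = (α_ξ^0, …, α_ξ^n)`. -/
def schmidtRankN (n : ℕ) (d : Fin (n + 1) → ℕ) (ξ : HilN n d) : Fin (n + 1) → ℕ :=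
  joinRanks n d {assocMapN n d ξ}

/-- The set `𝕊_{s_0,…,s_n}` of all finite sums `∑ |ξ_i⟩⟨ξ_i|` with `SR(ξ_i) ≤ (s_0, …, s_n)`. -/
def schmidtConeN (n : ℕ) (d s : Fin (n + 1) → ℕ) : Set (MatN n d) :=
  {ρ | ∃ (N : ℕ) (ξ : Fin N → HilN n d),
    (∀ i j, schmidtRankN n d (ξ i) j ≤ s j) ∧ ρ = ∑ i, ketBraN n d (ξ i) (ξ i)}

/-- The operator system `OMAX^{s_0}(L(H_0)) ⊗_max ⋯ ⊗_max OMAX^{s_n}(L(H_n))`. -/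
def omaxTensorN : (n : ℕ) → (d s : Fin (n + 1) → ℕ) → MatrixOrder (MatN n d)
  | 0, d, s => (matAlg (d 0)).omax (s 0)
  | n + 1, d, s =>
      ((matAlg (d 0)).omax (s 0)).maxTensor (omaxTensorN n (Fin.tail d) (Fin.tail s))

end Multipartite

end SchmidtNumber

end

/-! The idea is to describe all the cones M_n(S)⁺, not only n = 1, since both constructions use
higher levels. For every system S involved, M_n(S)⁺ is the set of finite sums of Gram matrices
[|ξ_k⟩⟨ξ_l|], where the family ξ_1, …, ξ_n has jointly bounded Schmidt rank (`gramCone`,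
`IsSchmidtSystem`). Hence the rank bound R is a condition on sets of vectors, depending only on
their linear combinations. At n = 1 a family is a single vector, which gives the theorem.

Algebra. Compressing a Gram matrix by α replaces the family by linear combinations of it, so R
survives. For one party, a family spanning at most s dimensions is a linear image of s vectors; this
identifies D^{max,s} (`mem_omaxCone_iff`). For one more party, Gram matrices of (u_i) and (w_j)
tensor to that of (u_i ⊗ w_j). Conversely, a family of bounded rank expands as ξ_k = ∑_i u_i ⊗
w_{k,i} with s vectors u_i and with all w_{k,i} jointly satisfying the remaining bounds
(`TensorRankCondition.exists_expansion`). Iterating this expansion gives Ω as well.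

Topology. Archimedeanization adds nothing because these cones are closed: bounding the dimension of
a span is a closed condition, so the normalized generators form a compact set, on which a trace
functional is positive (`RankCondition.mem_of_forall_add_smul_mem`).

Finally, duality and injectivity of ξ ↦ Λ_ξ identify R on {ξ} with the Schmidt rank bound
(`finrank_biSup_orthogonal_ker`). -/

open scoped TensorProduct ComplexOrder
noncomputable section
namespace SchmidtNumber
open Module

/-! ### Closedness of cones over compact sets -/

/-- In finite dimension, the convex hull of a compact set is compact. -/
theorem isCompact_convexHull_of_finiteDimensional {W : Type*} [NormedAddCommGroup W]
    [NormedSpace ℝ W] [FiniteDimensional ℝ W] {K : Set W} (hK : IsCompact K) :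
    IsCompact (convexHull ℝ K) := by
  rcases K.eq_empty_or_nonempty with rfl | ⟨k₀, hk₀⟩
  · simp
  -- Carathéodory: dim W + 1 points suffice, so the hull is a continuous image of simplex × K^N.
  -- Shorter combinations are padded with weight 0 and the point k₀.
  let N := finrank ℝ W + 1
  have hc : IsCompact ((fun p : (Fin N → ℝ) × (Fin N → W) => ∑ i, p.1 i • p.2 i) ''
      (stdSimplex ℝ (Fin N) ×ˢ Set.univ.pi fun _ => K)) :=
    ((isCompact_stdSimplex ℝ (Fin N)).prod (isCompact_univ_pi fun _ => hK)).image (by fun_prop)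
  convert hc using 1
  ext x
  constructor
  · intro hx
    obtain ⟨ι, _, z, w, hz, hind, hw, hsum, rfl⟩ := eq_pos_convex_span_of_mem_convexHull hx
    have hcard : Fintype.card ι ≤ Fintype.card (Fin N) := by
      have := hind.card_le_finrank_succ
      have h2 := Submodule.finrank_le (vectorSpan ℝ (Set.range z))
      simp only [Fintype.card_fin, N]
      omega
    obtain ⟨f⟩ := Function.Embedding.nonempty_of_card_le hcard
    refine ⟨(Function.extend f w 0, Function.extend f z fun _ => k₀), ⟨⟨fun i => ?_, ?_⟩, ?_⟩, ?_⟩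
    · by_cases h : ∃ a, f a = i
      · obtain ⟨a, rfl⟩ := h
        simpa [f.injective.extend_apply] using (hw a).le
      · simp [Function.extend_apply' _ _ _ h]
    · rw [← hsum, ← Finset.sum_subset (Finset.subset_univ (Finset.univ.map f)), Finset.sum_map]
      · simp [f.injective.extend_apply]
      · intro i _ hi
        have h : ¬ ∃ a, f a = i := by simpa using hi
        simp [Function.extend_apply' _ _ _ h]
    · intro i _
      by_cases h : ∃ a, f a = i
      · obtain ⟨a, rfl⟩ := h
        simpa [f.injective.extend_apply] using hz ⟨a, rfl⟩
      · simpa [Function.extend_apply' _ _ _ h] using hk₀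
    · dsimp only
      rw [← Finset.sum_subset (Finset.subset_univ (Finset.univ.map f)), Finset.sum_map]
      · simp [f.injective.extend_apply]
      · intro i _ hi
        have h : ¬ ∃ a, f a = i := by simpa using hi
        simp [Function.extend_apply' _ _ _ h]
  · rintro ⟨⟨w, z⟩, ⟨⟨hw, hs⟩, hz⟩, rfl⟩
    exact (convex_convexHull ℝ K).sum_mem (fun i _ => hw i) hs
      fun i _ => subset_convexHull ℝ K (hz i (Set.mem_univ i))

/-- A cone generated by a compact set on which some linear functional is positive is closed under
limits along lines. -/
theorem mem_cone_of_forall_add_smul_mem {W : Type*} [NormedAddCommGroup W]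
    [NormedSpace ℝ W] [FiniteDimensional ℝ W] {K : Set W} (hK : IsCompact K) (τ : W →ₗ[ℝ] ℝ)
    (hτ : ∀ k ∈ K, 0 < τ k) (C : AddSubmonoid W) (hKC : K ⊆ C)
    (hsmul : ∀ c : ℝ, 0 ≤ c → ∀ x ∈ C, c • x ∈ C)
    (hgen : C ≤ AddSubmonoid.closure {x | ∃ c : ℝ, 0 ≤ c ∧ ∃ k ∈ K, x = c • k})
    {x e : W} (h : ∀ ε : ℝ, 0 < ε → x + ε • e ∈ C) : x ∈ C := by
  have hconv : convexHull ℝ K ⊆ C := convexHull_min hKC fun y hy z hz a b ha hb _ =>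
    C.add_mem (hsmul a ha y hy) (hsmul b hb z hz)
  -- The convex hull of K is a base: every nonzero element of C is a positive multiple of a point of
  -- it.
  have hform : ∀ y ∈ C, y = 0 ∨ ∃ t : ℝ, 0 < t ∧ ∃ c ∈ convexHull ℝ K, y = t • c := by
    intro y hy
    have hy' := hgen hy
    clear hy
    induction hy' using AddSubmonoid.closure_induction with
    | mem y hy =>
      obtain ⟨t, ht, k, hk, rfl⟩ := hy
      rcases ht.eq_or_lt with rfl | ht
      · simp
      · exact Or.inr ⟨t, ht, k, subset_convexHull ℝ K hk, rfl⟩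
    | zero => exact Or.inl rfl
    | add y z hy hz ihy ihz =>
      rcases ihy with rfl | ⟨t, ht, c, hc, rfl⟩
      · simpa using ihz
      rcases ihz with rfl | ⟨t', ht', c', hc', rfl⟩
      · exact Or.inr ⟨t, ht, c, hc, by simp⟩
      refine Or.inr ⟨t + t', by positivity, (t / (t + t')) • c + (t' / (t + t')) • c', ?_, ?_⟩
      · exact convex_convexHull ℝ K hc hc' (by positivity) (by positivity) (by field_simp)
      · rw [smul_add, smul_smul, smul_smul]
        congr 2 <;> field_simp
  have hcc := isCompact_convexHull_of_finiteDimensional hK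
  have hτc : ∀ c ∈ convexHull ℝ K, 0 < τ c := fun c hc =>
    convexHull_min hτ (convex_halfSpace_gt τ.isLinear 0) hc
  obtain ⟨δ, hδ, hδc⟩ := hcc.exists_forall_le'
    (LinearMap.continuous_of_finiteDimensional τ).continuousOn hτc
  -- On the hull τ ≥ δ > 0, so for ε < 1 the multiplier t in x + ε e = t c satisfies t ≤ T. These
  -- points stay in the compact set Z ⊆ C.
  let T := (|τ x| + |τ e|) / δ
  let Z : Set W := insert 0 ((fun p : ℝ × W => p.1 • p.2) '' (Set.Icc 0 T ×ˢ convexHull ℝ K))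
  have hZ : IsClosed Z :=
    ((isCompact_Icc.prod hcc).image (by fun_prop)).insert 0 |>.isClosed
  have hZC : Z ⊆ C := by
    rintro _ (rfl | ⟨⟨t, c⟩, ⟨ht, hc⟩, rfl⟩)
    · exact C.zero_mem
    · exact hsmul t ht.1 c (hconv hc)
  apply hZC
  have hlim : Filter.Tendsto (fun ε : ℝ => x + ε • e) (nhdsWithin 0 (Set.Ioi 0)) (nhds x) := by
    have : Continuous fun ε : ℝ => x + ε • e := by fun_prop
    simpa using (this.tendsto 0).mono_left nhdsWithin_le_nhds
  refine hZ.mem_of_tendsto hlim ?_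
  filter_upwards [Ioo_mem_nhdsGT (zero_lt_one' ℝ)] with ε hε
  rcases hform _ (h ε hε.1) with h0 | ⟨t, ht, c, hc, htc⟩
  · rw [h0]; exact Or.inl rfl
  · refine Or.inr ⟨(t, c), ⟨⟨ht.le, ?_⟩, hc⟩, htc.symm⟩
    rw [le_div_iff₀ hδ]
    calc t * δ ≤ t * τ c := by gcongr; exact hδc c hc
      _ = τ (x + ε • e) := by rw [htc, map_smul, smul_eq_mul]
      _ = τ x + ε * τ e := by simp
      _ ≤ |τ x| + 1 * |τ e| := by
        refine add_le_add (le_abs_self _) ?_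
        exact (mul_le_mul_of_nonneg_left (le_abs_self _) hε.1.le).trans
          (mul_le_mul_of_nonneg_right hε.2.le (abs_nonneg _))
      _ = _ := by ring

/-! ### Lower semicontinuity of the dimension of a span -/

/-- A map into a complex vector space all of whose compositions with linear functionals are
continuous. -/
def WeaklyContinuous {X V : Type*} [TopologicalSpace X] [AddCommGroup V] [Module ℂ V]
    (f : X → V) : Prop :=
  ∀ φ : Dual ℂ V, Continuous fun x => φ (f x)

theorem WeaklyContinuous.linearMap_comp {X V W : Type*} [TopologicalSpace X] [AddCommGroup V]
    [Module ℂ V] [AddCommGroup W] [Module ℂ W] {f : X → V} (hf : WeaklyContinuous f)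
    (L : V →ₗ[ℂ] W) : WeaklyContinuous fun x => L (f x) :=
  fun φ => hf (φ ∘ₗ L)

/-- The complement says that some r + 1 members of the family are linearly independent, and linear
independence of finitely many vectors is an open condition. Weak continuity suffices because it
gives continuity of coordinates, so V needs no topology. -/
theorem isClosed_finrank_span_le {X V ι : Type*} [TopologicalSpace X] [AddCommGroup V]
    [Module ℂ V] [FiniteDimensional ℂ V] {f : ι → X → V} (hf : ∀ i, WeaklyContinuous (f i))
    (r : ℕ) : IsClosed {x | finrank ℂ (Submodule.span ℂ (Set.range fun i => f i x)) ≤ r} := by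
  let b := finBasis ℂ V
  have hopen : IsOpen (⋃ g : Fin (r + 1) → ι, (fun x => fun k => b.equivFun (f (g k) x)) ⁻¹'
      {v | LinearIndependent ℂ v}) := by
    refine isOpen_iUnion fun g => isOpen_setOfPred_linearIndependent.preimage ?_
    refine continuous_pi fun k => continuous_pi fun a => ?_
    exact hf (g k) (LinearMap.proj a ∘ₗ b.equivFun.toLinearMap)
  rw [← isOpen_compl_iff]
  convert hopen using 1
  ext x
  have hind (g : Fin (r + 1) → ι) : LinearIndependent ℂ (fun k => b.equivFun (f (g k) x)) ↔
      LinearIndependent ℂ (fun k => f (g k) x) :=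
    LinearMap.linearIndependent_iff b.equivFun.toLinearMap (LinearEquiv.ker _)
  simp only [Set.mem_compl_iff, Set.mem_ofPred_eq, not_le, Set.mem_iUnion, Set.mem_preimage, hind]
  constructor
  · intro h
    obtain ⟨v, hv, -, hli⟩ :=
      Submodule.exists_fun_fin_finrank_span_eq ℂ (Set.range fun i => f i x)
    choose g hg using hv
    refine ⟨g ∘ Fin.castLE h, ?_⟩
    have := hli.comp (Fin.castLE h) (Fin.castLE_injective h)
    have heq : (fun k => f ((g ∘ Fin.castLE h) k) x) = v ∘ Fin.castLE h :=
      funext fun k => hg _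
    rw [heq]
    exact this
  · rintro ⟨g, hg⟩
    have := finrank_span_eq_card hg
    rw [Fintype.card_fin] at this
    rw [← Nat.succ_le_iff, Nat.succ_eq_add_one, ← this]
    refine Submodule.finrank_mono (Submodule.span_mono ?_)
    rintro _ ⟨k, rfl⟩
    exact ⟨g k, rfl⟩

/-! ### Expansions in few vectors -/

/-- Vectors of a space of dimension at most `s` expand linearly in a fixed family of `s` vectors. -/
theorem exists_expansion {V : Type*} [AddCommGroup V] [Module ℂ V] [FiniteDimensional ℂ V]
    {s : ℕ} (h : finrank ℂ V ≤ s) :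
    ∃ (x : Fin s → V) (l : Fin s → Dual ℂ V), ∀ v, v = ∑ i, l i v • x i := by
  let b := finBasis ℂ V
  refine ⟨fun i => if hi : (i : ℕ) < finrank ℂ V then b ⟨i, hi⟩ else 0,
    fun i => if hi : (i : ℕ) < finrank ℂ V then b.coord ⟨i, hi⟩ else 0, fun v => ?_⟩
  rw [← Finset.sum_subset (Finset.subset_univ (Finset.univ.map (Fin.castLEEmb h))),
    Finset.sum_map]
  · simp
  · intro i _ hi
    have : ¬ (i : ℕ) < finrank ℂ V := fun hlt => by
      apply hi
      simp [Fin.ext_iff, Fin.exists_iff, hlt]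
    simp [this]

/-! ### Compression of matrices over a vector space -/

section Conj

variable {V W : Type*} [AddCommGroup V] [Module ℂ V] [AddCommGroup W] [Module ℂ W]
  {ι κ κ' : Type*} [Fintype κ] [Fintype κ']

theorem conj_apply (α : Matrix ι κ ℂ) (X : Matrix κ κ V) (i j : ι) :
    conj α X i j = ∑ k, ∑ l, (α i k * star (α j l)) • X k l := rfl

theorem tmulMatrix_apply {ι κ : Type*} (X : Matrix ι ι V) (Y : Matrix κ κ W) (i j : ι × κ) :
    tmulMatrix X Y i j = X i.1 j.1 ⊗ₜ[ℂ] Y i.2 j.2 := rfl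

theorem conj_add (α : Matrix ι κ ℂ) (X Y : Matrix κ κ V) :
    conj α (X + Y) = conj α X + conj α Y := by
  ext i j
  simp [conj_apply, Finset.sum_add_distrib]

theorem conj_zero (α : Matrix ι κ ℂ) : conj α (0 : Matrix κ κ V) = 0 := by
  ext i j
  simp [conj_apply]

theorem conj_submatrix (e : κ' ≃ κ) (α : Matrix ι κ ℂ) (X : Matrix κ κ V) :
    conj (α.submatrix id e) (X.submatrix e e) = conj α X := by
  ext i j
  simp only [conj_apply, Matrix.submatrix_apply, id]
  rw [Equiv.sum_comp e fun k => ∑ l, (α i k * star (α j (e l))) • X k (e l)]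
  exact Finset.sum_congr rfl fun k _ => Equiv.sum_comp e fun l => (α i k * star (α j l)) • X k l

end Conj

/-! ### Cones spanned by the matrices `[|ξ_k⟩⟨ξ_l|]` -/

variable {H M : Type} [AddCommGroup H] [Module ℂ H] [AddCommGroup M] [Module ℂ M]

/-- The matrix `[B(ξ_k, ξ_l)]` over `M` defined by a family `ξ` of vectors. -/
def gramMatrix (B : H →ₗ[ℂ] H →ₛₗ[starRingEnd ℂ] M) {κ : Type} (ξ : κ → H) : Matrix κ κ M :=
  Matrix.of fun k l => B (ξ k) (ξ l)

/-- The cone of all finite sums of matrices `[B(ξ_k, ξ_l)]` defined by families satisfying `R`. -/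
def gramCone (B : H →ₗ[ℂ] H →ₛₗ[starRingEnd ℂ] M) (R : Set H → Prop) (κ : Type) :
    AddSubmonoid (Matrix κ κ M) :=
  AddSubmonoid.closure {X | ∃ ξ : κ → H, R (Set.range ξ) ∧ X = gramMatrix B ξ}

/-- The properties shared by the conditions "the Schmidt rank is at most `s`" on sets of vectors. -/
structure RankCondition (B : H →ₗ[ℂ] H →ₛₗ[starRingEnd ℂ] M) (R : Set H → Prop) : Prop where
  mono : ∀ {F G : Set H}, F ⊆ Submodule.span ℂ G → R G → R F
  empty : R ∅
  closed : ∀ {X ι : Type} [TopologicalSpace X] (f : ι → X → H), (∀ i, WeaklyContinuous (f i)) →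
    IsClosed {x | R (Set.range fun i => f i x)}
  trace : ∃ τ : Dual ℂ M, ∀ ξ : H, ξ ≠ 0 → 0 < τ (B ξ ξ)

theorem gramMatrix_mem {B : H →ₗ[ℂ] H →ₛₗ[starRingEnd ℂ] M} {R : Set H → Prop} {κ : Type}
    {ξ : κ → H} (h : R (Set.range ξ)) : gramMatrix B ξ ∈ gramCone B R κ :=
  AddSubmonoid.subset_closure ⟨ξ, h, rfl⟩

/-- Sesquilinearity moves α into the family. Hence any R that passes to spans gives a cone stable
under compression. -/
theorem conj_gramMatrix (B : H →ₗ[ℂ] H →ₛₗ[starRingEnd ℂ] M) {ι κ : Type} [Fintype κ]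
    (α : Matrix ι κ ℂ) (ξ : κ → H) :
    conj α (gramMatrix B ξ) = gramMatrix B fun i => ∑ k, α i k • ξ k := by
  ext i j
  simp only [conj_apply, gramMatrix, Matrix.of_apply, map_sum, map_smul, LinearMap.sum_apply,
    LinearMap.smul_apply, LinearMap.map_smulₛₗ, Finset.smul_sum, smul_smul, RCLike.star_def]
  rw [Finset.sum_comm]
  simp only [mul_comm]

theorem gramMatrix_smul (B : H →ₗ[ℂ] H →ₛₗ[starRingEnd ℂ] M) {κ : Type} (c : ℂ)
    (ξ : κ → H) : gramMatrix B (fun k => c • ξ k) = (c * star c) • gramMatrix B ξ := by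
  ext i j
  simp [gramMatrix, smul_smul, mul_comm]

namespace RankCondition

variable {B : H →ₗ[ℂ] H →ₛₗ[starRingEnd ℂ] M} {R : Set H → Prop}

theorem conj_mem (hR : RankCondition B R) {ι κ : Type} [Fintype κ]
    (α : Matrix ι κ ℂ) {X : Matrix κ κ M} (hX : X ∈ gramCone B R κ) : conj α X ∈ gramCone B R ι := by
  induction hX using AddSubmonoid.closure_induction with
  | mem X hX =>
    obtain ⟨ξ, hξ, rfl⟩ := hX
    rw [conj_gramMatrix]
    refine gramMatrix_mem (hR.mono ?_ hξ)
    rintro _ ⟨i, rfl⟩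
    exact Submodule.sum_mem _ fun k _ => Submodule.smul_mem _ _ (Submodule.subset_span ⟨k, rfl⟩)
  | zero => rw [conj_zero]; exact zero_mem _
  | add X Y _ _ hX hY => rw [conj_add]; exact add_mem hX hY

theorem submatrix_mem (hR : RankCondition B R) {κ κ' : Type} (e : κ' → κ) {X : Matrix κ κ M}
    (hX : X ∈ gramCone B R κ) : X.submatrix e e ∈ gramCone B R κ' := by
  induction hX using AddSubmonoid.closure_induction with
  | mem X hX =>
    obtain ⟨ξ, hξ, rfl⟩ := hX
    refine gramMatrix_mem (B := B) (ξ := ξ ∘ e) (hR.mono ?_ hξ)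
    exact (Set.range_comp_subset_range e ξ).trans Submodule.subset_span
  | zero => exact zero_mem _
  | add X Y _ _ hX hY => exact add_mem hX hY

theorem smul_mem (hR : RankCondition B R) {κ : Type} {c : ℝ} (hc : 0 ≤ c) {X : Matrix κ κ M}
    (hX : X ∈ gramCone B R κ) : (c : ℂ) • X ∈ gramCone B R κ := by
  induction hX using AddSubmonoid.closure_induction with
  | mem X hX =>
    obtain ⟨ξ, hξ, rfl⟩ := hX
    have : (c : ℂ) = (Real.sqrt c : ℂ) * star (Real.sqrt c : ℂ) := by
      simp only [RCLike.star_def, Complex.conj_ofReal]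
      exact_mod_cast (Real.mul_self_sqrt hc).symm
    rw [this, ← gramMatrix_smul]
    refine gramMatrix_mem (hR.mono ?_ hξ)
    rintro _ ⟨i, rfl⟩
    exact Submodule.smul_mem _ _ (Submodule.subset_span ⟨i, rfl⟩)
  | zero => rw [smul_zero]; exact zero_mem _
  | add X Y _ _ hX hY => rw [smul_add]; exact add_mem hX hY

/-- Every element of the cone is a nonempty sum of generators. -/
theorem exists_sum (hR : RankCondition B R) {κ : Type} {X : Matrix κ κ M}
    (hX : X ∈ gramCone B R κ) : ∃ (N : ℕ) (ξ : Fin N → κ → H), 0 < N ∧ (∀ t, R (Set.range (ξ t))) ∧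
      X = ∑ t, gramMatrix B (ξ t) := by
  induction hX using AddSubmonoid.closure_induction with
  | mem X hX =>
    obtain ⟨ξ, hξ, rfl⟩ := hX
    exact ⟨1, fun _ => ξ, one_pos, fun _ => hξ, by simp⟩
  -- The definitions of the cones require at least one block, so 0 is written as the Gram matrix of
  -- the zero family, whose range lies in the span of ∅.
  | zero =>
    refine ⟨1, fun _ _ => 0, one_pos, fun _ => hR.mono ?_ hR.empty, ?_⟩
    · rintro _ ⟨i, rfl⟩
      exact zero_mem _
    · ext i j
      simp [gramMatrix]
  | add X Y _ _ hX hY =>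
    obtain ⟨N, ξ, hN, hξ, rfl⟩ := hX
    obtain ⟨N', η, hN', hη, rfl⟩ := hY
    refine ⟨N + N', Fin.append ξ η, by omega, fun t => ?_, by simp [Fin.sum_univ_add]⟩
    induction t using Fin.addCases with
    | left t => simpa using hξ t
    | right t => simpa using hη t

/-- The cones are closed, in the form relevant for archimedeanizations. -/
theorem mem_of_forall_add_smul_mem (hR : RankCondition B R) [FiniteDimensional ℂ H]
    [FiniteDimensional ℂ M] {κ : Type} [Fintype κ] {X E : Matrix κ κ M}
    (h : ∀ ε : ℝ, 0 < ε → X + (ε : ℂ) • E ∈ gramCone B R κ) : X ∈ gramCone B R κ := by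
  classical
  let b := finBasis ℂ H
  let vec : (κ → Fin (finrank ℂ H) → ℂ) → κ → H := fun x k => b.equivFun.symm (x k)
  have hvec : ∀ ξ : κ → H, vec (fun k => b.equivFun (ξ k)) = ξ := fun ξ => by
    ext k; simp [vec]
  let J : Matrix κ κ M ≃ₗ[ℂ] (Fin (finrank ℂ (Matrix κ κ M)) → ℂ) :=
    (finBasis ℂ (Matrix κ κ M)).equivFun
  let JR : Matrix κ κ M →+ (Fin (finrank ℂ (Matrix κ κ M)) → ℂ) := J.toLinearMap.toAddMonoidHom
  have hJ_smul : ∀ (c : ℝ) (Y : Matrix κ κ M), J ((c : ℂ) • Y) = c • J Y := fun c Y => by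
    rw [map_smul]; rfl
  -- the quadratic map `x ↦ [B(ξ_k, ξ_l)]` is continuous in coordinates
  let T : (κ → κ → Fin (finrank ℂ H) → Fin (finrank ℂ H) → ℂ) →ₗ[ℂ] Matrix κ κ M :=
    { toFun := fun c => Matrix.of fun k l => ∑ a, ∑ a', c k l a a' • B (b a) (b a')
      map_add' := fun c c' => by
        ext k l
        simp [add_smul, Finset.sum_add_distrib]
      map_smul' := fun z c => by
        ext k l
        simp [smul_smul, Finset.smul_sum] }
  have hT : ∀ x, gramMatrix B (vec x) = T fun k l a a' => x k a * star (x l a') := by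
    intro x
    ext k l
    simp only [gramMatrix, vec, T, LinearMap.coe_mk, AddHom.coe_mk, Matrix.of_apply,
      Basis.equivFun_symm_apply, map_sum, map_smul, LinearMap.sum_apply,
      LinearMap.smul_apply, LinearMap.map_smulₛₗ, Finset.smul_sum, smul_smul, RCLike.star_def]
    rw [Finset.sum_comm]
    simp only [mul_comm]
  have hcont : Continuous fun x => J (gramMatrix B (vec x)) := by
    simp_rw [hT]
    exact (LinearMap.continuous_of_finiteDimensional (J.toLinearMap ∘ₗ T)).comp (by fun_prop)
  have hclosed : IsClosed {x | R (Set.range (vec x))} := by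
    refine hR.closed (fun k x => vec x k) fun k φ => ?_
    exact LinearMap.continuous_of_finiteDimensional
      (φ ∘ₗ b.equivFun.symm.toLinearMap ∘ₗ
        LinearMap.proj (R := ℂ) (φ := fun _ : κ => Fin (finrank ℂ H) → ℂ) k)
  -- Families with coordinates on the unit sphere that satisfy R form a compact set; their Gram
  -- matrices generate the cone. Everything is read in coordinates because H and M carry no norm.
  let K := (fun x => J (gramMatrix B (vec x))) ''
    (Metric.sphere 0 1 ∩ {x | R (Set.range (vec x))})
  have hK : IsCompact K := ((isCompact_sphere 0 1).inter_right hclosed).image hcont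
  obtain ⟨τ, hτ⟩ := hR.trace
  let τ' : Matrix κ κ M →ₗ[ℂ] ℂ := ∑ k, τ ∘ₗ Matrix.entryLinearMap ℂ M k k
  let σ : (Fin (finrank ℂ (Matrix κ κ M)) → ℂ) →ₗ[ℝ] ℝ :=
    Complex.reLm ∘ₗ (τ' ∘ₗ J.symm.toLinearMap).restrictScalars ℝ
  have hσ : ∀ k ∈ K, 0 < σ k := by
    rintro _ ⟨x, ⟨hx, -⟩, rfl⟩
    have hx0 : x ≠ 0 := by
      rintro rfl
      simp at hx
    obtain ⟨k, hk⟩ := Function.ne_iff.1 hx0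
    have hτ0 : ∀ ξ, 0 ≤ (τ (B ξ ξ)).re := fun ξ => by
      by_cases h0 : ξ = 0
      · simp [h0]
      · exact (Complex.lt_def.1 (hτ ξ h0)).1.le
    have : σ (J (gramMatrix B (vec x))) = ∑ k, (τ (B (vec x k) (vec x k))).re := by
      simp [σ, τ', gramMatrix]
    rw [this]
    refine Finset.sum_pos' (fun k _ => hτ0 _) ⟨k, Finset.mem_univ _, ?_⟩
    refine (Complex.lt_def.1 (hτ _ ?_)).1
    exact (LinearEquiv.map_ne_zero_iff _).2 hk
  have key := mem_cone_of_forall_add_smul_mem hK σ hσ ((gramCone B R κ).map JR) ?_ ?_ ?_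
    (x := J X) (e := J E) ?_
  · obtain ⟨Y, hY, hYX⟩ := key
    rwa [← J.injective hYX]
  · rintro _ ⟨x, ⟨-, hx⟩, rfl⟩
    exact ⟨_, gramMatrix_mem hx, rfl⟩
  · rintro c hc _ ⟨Y, hY, rfl⟩
    exact ⟨_, hR.smul_mem hc hY, hJ_smul c Y⟩
  · rw [gramCone, AddMonoidHom.map_mclosure, AddSubmonoid.closure_le]
    rintro _ ⟨_, ⟨ξ, hξ, rfl⟩, rfl⟩
    let x : κ → Fin (finrank ℂ H) → ℂ := fun k => b.equivFun (ξ k)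
    by_cases hx : x = 0
    · have : gramMatrix B ξ = 0 := by
        rw [← hvec ξ]
        change gramMatrix B (vec x) = 0
        rw [hx]
        ext i j
        simp [gramMatrix, vec]
      rw [this, map_zero]
      exact zero_mem _
    have hn : ‖x‖ ≠ 0 := norm_ne_zero_iff.2 hx
    -- Gram matrices are quadratic in the family, so normalizing by ‖x‖ costs the factor ‖x‖².
    let y : κ → Fin (finrank ℂ H) → ℂ := (‖x‖⁻¹ : ℂ) • x
    have hy : vec y = fun k => (‖x‖⁻¹ : ℂ) • ξ k := by
      ext k
      change b.equivFun.symm ((‖x‖⁻¹ : ℂ) • b.equivFun (ξ k)) = _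
      rw [map_smul, LinearEquiv.symm_apply_apply]
    refine AddSubmonoid.subset_closure ⟨‖x‖ ^ 2, by positivity, J (gramMatrix B (vec y)),
      ⟨y, ⟨?_, ?_⟩, rfl⟩, ?_⟩
    · simp [y, norm_smul, hn]
    · change R (Set.range (vec y))
      rw [hy]
      refine hR.mono ?_ hξ
      rintro _ ⟨i, rfl⟩
      exact Submodule.smul_mem _ _ (Submodule.subset_span ⟨i, rfl⟩)
    · rw [← hJ_smul, hy, gramMatrix_smul, smul_smul]
      have : (((‖x‖ ^ 2 : ℝ) : ℂ) * ((‖x‖⁻¹ : ℂ) * star (‖x‖⁻¹ : ℂ))) = 1 := by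
        have : (‖x‖ : ℂ) ≠ 0 := by exact_mod_cast hn
        simp only [star_inv₀, RCLike.star_def, Complex.conj_ofReal]
        push_cast
        field_simp
      rw [this, one_smul]
      rfl
  · intro ε hε
    exact ⟨_, h ε hε, by change J _ = _; rw [map_add, hJ_smul]⟩

end RankCondition

/-- The operator system `S` is described by the rank condition `R`: its positive matrices are the
sums of the matrices `[B(ξ_k, ξ_l)]` with `ξ` satisfying `R`. -/
structure IsSchmidtSystem {H M : Type} [AddCommGroup H] [Module ℂ H] [AddCommGroup M] [Module ℂ M]
    (B : H →ₗ[ℂ] H →ₛₗ[starRingEnd ℂ] M) (R : Set H → Prop) (S : MatrixOrder M) : Prop where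
  rank : RankCondition B R
  unit_mem : ∀ n, Matrix.diagonal (fun _ : Fin n => S.unit) ∈ gramCone B R (Fin n)
  pos_iff : ∀ n X, X ∈ S.pos n ↔ X ∈ gramCone B R (Fin n)

/-- Closedness of the cone gives one inclusion; for the other, adding ε times the unit stays in the
cone because the unit lies in it. -/
theorem RankCondition.archimedeanization {H M : Type} [AddCommGroup H] [Module ℂ H]
    [AddCommGroup M] [Module ℂ M] [FiniteDimensional ℂ H] [FiniteDimensional ℂ M]
    {B : H →ₗ[ℂ] H →ₛₗ[starRingEnd ℂ] M} {R : Set H → Prop} (hR : RankCondition B R) {e : M}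
    {D : (n : ℕ) → Set (Matrix (Fin n) (Fin n) M)}
    (he : ∀ n, Matrix.diagonal (fun _ : Fin n => e) ∈ gramCone B R (Fin n))
    (hD : ∀ n X, X ∈ D n ↔ X ∈ gramCone B R (Fin n)) :
    IsSchmidtSystem B R (MatrixOrder.archimedeanization e D) where
  rank := hR
  unit_mem := he
  pos_iff n X := by
    constructor
    · intro h
      exact hR.mem_of_forall_add_smul_mem fun ε hε => (hD n _).1 (h ε hε)
    · intro h ε hε
      exact (hD n _).2 (add_mem h (hR.smul_mem hε.le (he n)))

/-! ### Block diagonal matrices -/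

/-- This turns a sum of compressed matrices into a single compression of a direct sum, the shape
used in the definitions of the cones. -/
theorem conj_blockDiagonal {V ι κ τ : Type*} [AddCommGroup V] [Module ℂ V] [Fintype κ] [Fintype τ]
    [DecidableEq τ] (α : Matrix ι (κ × τ) ℂ) (s : τ → Matrix κ κ V) :
    conj α (Matrix.blockDiagonal s) = ∑ t, conj (Matrix.of fun i k => α i (k, t)) (s t) := by
  ext i j
  simp only [conj_apply, Fintype.sum_prod_type, Matrix.blockDiagonal_apply, smul_ite, smul_zero,
    Finset.sum_ite_eq, Finset.mem_univ, if_true, Matrix.sum_apply, Matrix.of_apply]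
  rw [Finset.sum_comm]

theorem conj_one {V κ : Type*} [AddCommGroup V] [Module ℂ V] [Fintype κ] [DecidableEq κ]
    (X : Matrix κ κ V) : conj (1 : Matrix κ κ ℂ) X = X := by
  ext i j
  simp [conj_apply, Matrix.one_apply, ite_smul]

theorem RankCondition.blockDiagonal_mem {H M : Type} [AddCommGroup H] [Module ℂ H]
    [AddCommGroup M] [Module ℂ M] {B : H →ₗ[ℂ] H →ₛₗ[starRingEnd ℂ] M} {R : Set H → Prop}
    (hR : RankCondition B R) {κ τ : Type} [Fintype κ] [Fintype τ] [DecidableEq τ]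
    {s : τ → Matrix κ κ M} (hs : ∀ t, s t ∈ gramCone B R κ) :
    Matrix.blockDiagonal s ∈ gramCone B R (κ × τ) := by
  classical
  rw [← conj_one (Matrix.blockDiagonal s), conj_blockDiagonal]
  exact sum_mem fun t _ => hR.conj_mem _ (hs t)

/-! ### One party -/

/-- The set `F` spans a space of dimension at most `s`. -/
def SpanRankLE (d s : ℕ) (F : Set (Hil d)) : Prop :=
  finrank ℂ (Submodule.span ℂ F) ≤ s

theorem ketBra_apply (d : ℕ) (u v : Hil d) (i j : Fin d) :
    ketBra d u v i j = u i * star (v j) := rfl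

theorem trace_ketBra (d : ℕ) (u v : Hil d) : (ketBra d u v).trace = ∑ i, u i * star (v i) := rfl

theorem rankCondition_spanRankLE (d s : ℕ) : RankCondition (ketBra d) (SpanRankLE d s) where
  mono h hG := (Submodule.finrank_mono (Submodule.span_le.2 h)).trans hG
  empty := by rw [SpanRankLE, Submodule.span_empty, finrank_bot]; exact Nat.zero_le s
  closed f hf := isClosed_finrank_span_le hf s
  trace := by
    refine ⟨Matrix.traceLinearMap (Fin d) ℂ ℂ, fun ξ hξ => ?_⟩
    rw [Matrix.traceLinearMap_apply, trace_ketBra]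
    have hne : ∃ i, ξ i ≠ 0 := by
      by_contra! h
      exact hξ (PiLp.ext h)
    obtain ⟨i, hi⟩ := hne
    exact Finset.sum_pos' (fun i _ => mul_star_self_nonneg _)
      ⟨i, Finset.mem_univ _, (mul_star_self_pos (isUnit_iff_ne_zero.2 hi).isRegular)⟩

theorem gramMatrix_ketBra_mem_pos (d k : ℕ) (u : Fin k → Hil d) :
    gramMatrix (ketBra d) u ∈ (matAlg d).pos k :=
  Matrix.posSemidef_vecMulVec_self_star fun p : Fin k × Fin d => u p.1 p.2

theorem spanRankLE_range {d k : ℕ} (u : Fin k → Hil d) : SpanRankLE d k (Set.range u) :=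
  (finrank_range_le_card (R := ℂ) u).trans (Fintype.card_fin k).le

/-- A positive semidefinite matrix is a sum of |v⟩⟨v| with v ∈ ℂ^k ⊗ ℂ^d. Such a v is a family of k
vectors of ℂ^d, which spans at most k dimensions automatically. -/
theorem mem_gramCone_of_mem_pos {d k : ℕ} {X : Matrix (Fin k) (Fin k) (Mat d)}
    (hX : X ∈ (matAlg d).pos k) : X ∈ gramCone (ketBra d) (SpanRankLE d k) (Fin k) := by
  obtain ⟨m, v, hv⟩ := Matrix.posSemidef_iff_eq_sum_vecMulVec.1 hX
  have : X = ∑ t, gramMatrix (ketBra d)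
      (fun k => (WithLp.toLp 2 fun a => v t (k, a) : Hil d)) := by
    ext k l a b
    have := congrFun (congrFun hv (k, a)) (l, b)
    simpa [Matrix.sum_apply, Matrix.vecMulVec_apply, gramMatrix, ketBra_apply] using this
  rw [this]
  exact sum_mem fun t _ => gramMatrix_mem (spanRankLE_range _)

theorem exists_family_expansion {V κ : Type*} [AddCommGroup V] [Module ℂ V]
    [FiniteDimensional ℂ V] {s : ℕ} {ξ : κ → V}
    (h : finrank ℂ (Submodule.span ℂ (Set.range ξ)) ≤ s) :
    ∃ (u : Fin s → V) (α : κ → Fin s → ℂ), ξ = fun k => ∑ i, α k i • u i := by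
  obtain ⟨x, l, hxl⟩ := exists_expansion h
  refine ⟨fun i => x i, fun k i => l i ⟨ξ k, Submodule.subset_span ⟨k, rfl⟩⟩, ?_⟩
  ext k
  simpa using congrArg Subtype.val (hxl ⟨ξ k, Submodule.subset_span ⟨k, rfl⟩⟩)

/-- The blocks have size k, so they involve families of rank at most k, and compression keeps this
bound. Conversely, a family of rank at most k has an expansion in k vectors: their Gram matrix is
the block and the coefficients form α. -/
theorem mem_omaxCone_iff {d k : ℕ} (n : ℕ) (X : Matrix (Fin n) (Fin n) (Mat d)) :
    X ∈ (matAlg d).omaxCone k n ↔ X ∈ gramCone (ketBra d) (SpanRankLE d k) (Fin n) := by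
  have hR := rankCondition_spanRankLE d k
  constructor
  · rintro ⟨m, -, s, hs, α, rfl⟩
    exact hR.conj_mem _ (hR.blockDiagonal_mem fun t => mem_gramCone_of_mem_pos (hs t))
  · intro hX
    obtain ⟨N, ξ, hN, hξ, rfl⟩ := hR.exists_sum hX
    choose u α hu using fun t => exists_family_expansion (hξ t)
    refine ⟨N, hN, fun t => gramMatrix (ketBra d) (u t),
      fun t => gramMatrix_ketBra_mem_pos d k _, Matrix.of fun i p => α p.2 i p.1, ?_⟩
    rw [conj_blockDiagonal]
    refine Finset.sum_congr rfl fun t _ => ?_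
    rw [conj_gramMatrix, hu t]
    rfl

theorem one_eq_sum_ketBra (d : ℕ) :
    (1 : Mat d) = ∑ a, ketBra d (EuclideanSpace.single a 1) (EuclideanSpace.single a 1) := by
  ext i j
  simp [Matrix.sum_apply, ketBra_apply, Matrix.one_apply]

theorem isSchmidtSystem_omax (d : ℕ) {s : ℕ} (hs : 1 ≤ s) :
    IsSchmidtSystem (ketBra d) (SpanRankLE d s) ((matAlg d).omax s) := by
  refine (rankCondition_spanRankLE d s).archimedeanization (fun n => ?_) mem_omaxCone_iff
  -- Each generator uses the family with e_a in position k and 0 elsewhere. It has rank 1, which is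
  -- where 1 ≤ s enters.
  have : Matrix.diagonal (fun _ : Fin n => (1 : Mat d)) = ∑ k : Fin n, ∑ a,
      gramMatrix (ketBra d) (Pi.single k (EuclideanSpace.single a 1 : Hil d)) := by
    ext1 k l
    simp only [Matrix.sum_apply, gramMatrix, Matrix.of_apply, Matrix.diagonal_apply]
    split_ifs with h
    · subst h
      rw [Finset.sum_eq_single k]
      · simpa using one_eq_sum_ketBra d
      · intro k' _ hk'
        simp [Pi.single_eq_of_ne hk'.symm]
      · simp
    · refine (Finset.sum_eq_zero fun k' _ => Finset.sum_eq_zero fun a _ => ?_).symm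
      by_cases hk : k = k'
      · subst hk
        rw [Pi.single_eq_of_ne (Ne.symm h), map_zero]
      · rw [Pi.single_eq_of_ne hk, map_zero, LinearMap.zero_apply]
  change Matrix.diagonal (fun _ : Fin n => (1 : Mat d)) ∈ _
  rw [this]
  refine sum_mem fun k _ => sum_mem fun a _ => gramMatrix_mem ?_
  have hsub : Submodule.span ℂ (Set.range (Pi.single k (EuclideanSpace.single a 1 : Hil d))) ≤
      Submodule.span ℂ {(EuclideanSpace.single a 1 : Hil d)} := by
    rw [Submodule.span_le]
    rintro _ ⟨l, rfl⟩
    by_cases h : l = k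
    · subst h
      simp
    · rw [Pi.single_eq_of_ne h]
      exact zero_mem _
  exact (Submodule.finrank_mono hsub).trans (((finrank_span_le_card _).trans (by simp)).trans hs)

/-! ### Contractions of a tensor -/

section Contraction

variable {d : ℕ} {W : Type*} [AddCommGroup W] [Module ℂ W]

theorem toHom_tmul (u x : Hil d) (w : W) : toHom d W (u ⊗ₜ w) x = dot d u x • w := by
  simp [toHom]

theorem dot_apply (u x : Hil d) : dot d u x = ∑ i, u i * x i := rfl

theorem sum_single_tmul_toHom (ξ : Hil d ⊗[ℂ] W) :
    ξ = ∑ a, EuclideanSpace.single a (1 : ℂ) ⊗ₜ toHom d W ξ (EuclideanSpace.single a 1) := by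
  induction ξ using TensorProduct.induction_on with
  | zero => simp
  | tmul u w =>
    have hu : u = ∑ a, u a • EuclideanSpace.single a (1 : ℂ) := by
      ext i
      simp [Pi.single_apply]
    have hdot : ∀ a, dot d u (EuclideanSpace.single a 1) = u a := fun a => by
      simp [dot_apply]
    simp_rw [toHom_tmul, hdot, TensorProduct.tmul_smul, TensorProduct.smul_tmul',
      ← TensorProduct.sum_tmul]
    rw [← hu]
  | add ξ η hξ hη =>
    simp only [map_add, LinearMap.add_apply, TensorProduct.tmul_add, Finset.sum_add_distrib]
    rw [← hξ, ← hη]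

theorem toHom_injective : Function.Injective (toHom d W) := by
  intro ξ η h
  rw [sum_single_tmul_toHom ξ, sum_single_tmul_toHom η, h]

theorem toHom_map {W' : Type*} [AddCommGroup W'] [Module ℂ W'] (f : W →ₗ[ℂ] W')
    (ξ : Hil d ⊗[ℂ] W) :
    toHom d W' (TensorProduct.map LinearMap.id f ξ) = f ∘ₗ toHom d W ξ := by
  induction ξ using TensorProduct.induction_on with
  | zero => simp
  | tmul u w =>
    ext x
    simp [toHom_tmul]
  | add ξ η hξ hη => rw [map_add, map_add, hξ, hη, map_add, LinearMap.comp_add]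

/-- The linear map `ξ ↦ (φ ∘ toHom ξ)`, contraction of the second tensor factor. -/
def contractSnd (φ : Dual ℂ W) : Hil d ⊗[ℂ] W →ₗ[ℂ] Dual ℂ (Hil d) :=
  LinearMap.compRight ℂ φ ∘ₗ toHom d W

/-- The linear map `ξ ↦ toHom ξ x`, contraction of the first tensor factor. -/
def contractFst (x : Hil d) : Hil d ⊗[ℂ] W →ₗ[ℂ] W :=
  LinearMap.applyₗ x ∘ₗ toHom d W

theorem contractSnd_apply (φ : Dual ℂ W) (ξ : Hil d ⊗[ℂ] W) (x : Hil d) :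
    contractSnd φ ξ x = φ (toHom d W ξ x) := rfl

theorem contractFst_apply (x : Hil d) (ξ : Hil d ⊗[ℂ] W) :
    contractFst x ξ = toHom d W ξ x := rfl

end Contraction

/-! ### Adding one party -/

variable {H M : Type} [AddCommGroup H] [Module ℂ H] [AddCommGroup M] [Module ℂ M]

/-- The condition on sets of vectors of `ℂ^d ⊗ H` that the rank in the first factor is at most `s`
and that the contractions of the first factor satisfy `R`. -/
def TensorRankCondition (d s : ℕ) (R : Set H → Prop) (F : Set (Hil d ⊗[ℂ] H)) : Prop :=
  finrank ℂ (Submodule.span ℂ (Set.range fun p : F × Dual ℂ H => contractSnd p.2 p.1.1)) ≤ s ∧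
    R (Set.range fun p : F × Hil d => contractFst p.2 p.1.1)

theorem range_prod_range {X ι P V : Type*} (f : ι → X) (g : P → X → V) :
    (Set.range fun p : Set.range f × P => g p.2 p.1.1) =
      Set.range fun p : ι × P => g p.2 (f p.1) := by
  ext v
  constructor
  · rintro ⟨⟨⟨_, ⟨i, rfl⟩⟩, p⟩, rfl⟩
    exact ⟨(i, p), rfl⟩
  · rintro ⟨⟨i, p⟩, rfl⟩
    exact ⟨(⟨f i, i, rfl⟩, p), rfl⟩

theorem tensorRankCondition_range_iff {d s : ℕ} {R : Set H → Prop} {ι : Type*}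
    (ξ : ι → Hil d ⊗[ℂ] H) : TensorRankCondition d s R (Set.range ξ) ↔
      finrank ℂ (Submodule.span ℂ
        (Set.range fun p : ι × Dual ℂ H => contractSnd p.2 (ξ p.1))) ≤ s ∧
      R (Set.range fun p : ι × Hil d => contractFst p.2 (ξ p.1)) := by
  rw [TensorRankCondition, range_prod_range ξ fun (φ : Dual ℂ H) ζ => contractSnd φ ζ,
    range_prod_range ξ fun (x : Hil d) ζ => contractFst x ζ]

theorem range_subset_span_of_subset_span {V V' P : Type*} [AddCommGroup V] [Module ℂ V]
    [AddCommGroup V'] [Module ℂ V'] {F G : Set V} (h : F ⊆ Submodule.span ℂ G)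
    (L : P → V →ₗ[ℂ] V') : (Set.range fun p : F × P => L p.2 p.1.1) ⊆
      (Submodule.span ℂ (Set.range fun p : G × P => L p.2 p.1.1) : Set V') := by
  rintro _ ⟨⟨⟨ξ, hξ⟩, p⟩, rfl⟩
  have := Submodule.mem_map_of_mem (f := L p) (h hξ)
  rw [Submodule.map_span] at this
  refine Submodule.span_mono ?_ this
  rintro _ ⟨η, hη, rfl⟩
  exact ⟨(⟨η, hη⟩, p), rfl⟩

theorem tmul_gramMatrix {B : H →ₗ[ℂ] H →ₛₗ[starRingEnd ℂ] M} {d : ℕ} {ι κ : Type}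
    (u : ι → Hil d) (w : κ → H) :
    tmulMatrix (gramMatrix (ketBra d) u) (gramMatrix B w) =
      gramMatrix (TensorProduct.map₂ (ketBra d) B) fun p : ι × κ => u p.1 ⊗ₜ w p.2 := by
  ext p q
  simp [tmulMatrix_apply, gramMatrix, TensorProduct.map₂_apply_tmul]

theorem tmulMatrix_zero {V W ι κ : Type*} [AddCommGroup V] [Module ℂ V] [AddCommGroup W]
    [Module ℂ W] (X : Matrix ι ι V) : tmulMatrix X (0 : Matrix κ κ W) = 0 := by
  ext p q
  simp [tmulMatrix_apply]

theorem zero_tmulMatrix {V W ι κ : Type*} [AddCommGroup V] [Module ℂ V] [AddCommGroup W]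
    [Module ℂ W] (Y : Matrix κ κ W) : tmulMatrix (0 : Matrix ι ι V) Y = 0 := by
  ext p q
  simp [tmulMatrix_apply]

namespace RankCondition

variable {B : H →ₗ[ℂ] H →ₛₗ[starRingEnd ℂ] M} {R : Set H → Prop}

/-- The functional is trace ⊗ τ. Writing ξ = ∑ e_a ⊗ w_a, the cross terms have trace zero and there
remains ∑ τ(B(w_a, w_a)). -/
theorem tensor_trace (hR : RankCondition B R) (d : ℕ) :
    ∃ τ : Dual ℂ (Mat d ⊗[ℂ] M), ∀ ξ, ξ ≠ 0 → 0 < τ (TensorProduct.map₂ (ketBra d) B ξ ξ) := by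
  obtain ⟨τ, hτ⟩ := hR.trace
  let τ' : Dual ℂ (Mat d ⊗[ℂ] M) := (TensorProduct.lid ℂ ℂ).toLinearMap ∘ₗ
    TensorProduct.map (Matrix.traceLinearMap (Fin d) ℂ ℂ) τ
  refine ⟨τ', fun ξ hξ => ?_⟩
  let w : Fin d → H := fun a => toHom d H ξ (EuclideanSpace.single a 1)
  have hw : ξ = ∑ a, EuclideanSpace.single a (1 : ℂ) ⊗ₜ w a := sum_single_tmul_toHom ξ
  have hsum : τ' (TensorProduct.map₂ (ketBra d) B ξ ξ) = ∑ a, τ (B (w a) (w a)) := by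
    have htr : ∀ a b : Fin d, (ketBra d (EuclideanSpace.single a 1)
        (EuclideanSpace.single b 1)).trace = if a = b then 1 else 0 := fun a b => by
      rw [trace_ketBra]
      simp [eq_comm]
    rw [hw]
    simp [τ', LinearMap.sum_apply, TensorProduct.map₂_apply_tmul, htr]
  have hne : ∃ a, w a ≠ 0 := by
    by_contra! h
    exact hξ (by rw [hw]; simp [h])
  obtain ⟨a, ha⟩ := hne
  rw [hsum]
  refine Finset.sum_pos' (fun b _ => ?_) ⟨a, Finset.mem_univ a, hτ _ ha⟩
  by_cases hb : w b = 0
  · simp [hb]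
  · exact (hτ _ hb).le

theorem tensor (hR : RankCondition B R) (d s : ℕ) :
    RankCondition (TensorProduct.map₂ (ketBra d) B) (TensorRankCondition d s R) where
  mono h hG := ⟨(Submodule.finrank_mono (Submodule.span_le.2
      (range_subset_span_of_subset_span h contractSnd))).trans hG.1,
    hR.mono (range_subset_span_of_subset_span h contractFst) hG.2⟩
  empty := by
    have h0 : Set.range (Empty.elim : Empty → Hil d ⊗[ℂ] H) = ∅ := Set.range_eq_empty _
    rw [← h0, tensorRankCondition_range_iff]
    constructor
    · rw [Set.range_eq_empty, Submodule.span_empty, finrank_bot]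
      exact Nat.zero_le s
    · rw [Set.range_eq_empty]
      exact hR.empty
  closed {X ι} _ f hf := by
    have h1 : IsClosed {x | finrank ℂ (Submodule.span ℂ
        (Set.range fun p : ι × Dual ℂ H => contractSnd p.2 (f p.1 x))) ≤ s} :=
      isClosed_finrank_span_le (f := fun (p : ι × Dual ℂ H) x => contractSnd p.2 (f p.1 x))
        (fun p => (hf p.1).linearMap_comp (contractSnd p.2)) s
    have h2 : IsClosed {x | R (Set.range fun p : ι × Hil d => contractFst p.2 (f p.1 x))} :=
      hR.closed (fun (p : ι × Hil d) x => contractFst p.2 (f p.1 x))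
        fun p => (hf p.1).linearMap_comp (contractFst p.2)
    simp_rw [tensorRankCondition_range_iff]
    exact h1.inter h2
  trace := hR.tensor_trace d

/-- Contracting u_i ⊗ w_k gives multiples of the functional of u_i on one side and multiples of w_k
on the other, so both bounds are inherited. -/
theorem tmul_mem (hR : RankCondition B R) {d s : ℕ} {ι κ : Type} {P : Matrix ι ι (Mat d)}
    {Q : Matrix κ κ M} (hP : P ∈ gramCone (ketBra d) (SpanRankLE d s) ι)
    (hQ : Q ∈ gramCone B R κ) : tmulMatrix P Q ∈
      gramCone (TensorProduct.map₂ (ketBra d) B) (TensorRankCondition d s R) (ι × κ) := by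
  induction hP using AddSubmonoid.closure_induction with
  | mem P hP =>
    obtain ⟨u, hu, rfl⟩ := hP
    induction hQ using AddSubmonoid.closure_induction with
    | mem Q hQ =>
      obtain ⟨w, hw, rfl⟩ := hQ
      rw [tmul_gramMatrix]
      refine gramMatrix_mem ((tensorRankCondition_range_iff _).2 ⟨?_, hR.mono ?_ hw⟩)
      · refine le_trans ?_ hu
        refine le_trans (Submodule.finrank_mono ?_)
          (Submodule.finrank_map_le (dot d) (Submodule.span ℂ (Set.range u)))
        rw [Submodule.span_le]
        rintro _ ⟨⟨⟨i, k⟩, φ⟩, rfl⟩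
        have : contractSnd φ (u i ⊗ₜ[ℂ] w k) = φ (w k) • dot d (u i) := by
          ext x
          simp [contractSnd_apply, toHom_tmul, mul_comm]
        change contractSnd φ (u i ⊗ₜ[ℂ] w k) ∈ _
        rw [this]
        exact Submodule.smul_mem _ _
          (Submodule.mem_map_of_mem (Submodule.subset_span ⟨i, rfl⟩))
      · rintro _ ⟨⟨⟨i, k⟩, x⟩, rfl⟩
        change contractFst x (u i ⊗ₜ[ℂ] w k) ∈ _
        rw [contractFst_apply, toHom_tmul]
        exact Submodule.smul_mem _ _ (Submodule.subset_span ⟨k, rfl⟩)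
    | zero =>
      rw [tmulMatrix_zero]
      exact zero_mem _
    | add Q Q' _ _ hQ hQ' =>
      convert add_mem hQ hQ' using 1
      ext p q
      simp [tmulMatrix_apply, TensorProduct.tmul_add]
  | zero =>
    rw [zero_tmulMatrix]
    exact zero_mem _
  | add P P' _ _ hP hP' =>
    convert add_mem hP hP' using 1
    ext p q
    simp [tmulMatrix_apply, TensorProduct.add_tmul]

end RankCondition

/-- A family satisfying the rank condition on `ℂ^d ⊗ H` expands in `s` vectors of `ℂ^d`, with
coefficients satisfying `R`. -/
theorem TensorRankCondition.exists_expansion {B : H →ₗ[ℂ] H →ₛₗ[starRingEnd ℂ] M}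
    {R : Set H → Prop} (hR : RankCondition B R) {d s : ℕ} {ι : Type} {ξ : ι → Hil d ⊗[ℂ] H}
    (h : TensorRankCondition d s R (Set.range ξ)) :
    ∃ (u : Fin s → Hil d) (w : ι × Fin s → H), R (Set.range w) ∧
      ξ = fun k => ∑ i, u i ⊗ₜ w (k, i) := by
  obtain ⟨h1, h2⟩ := (tensorRankCondition_range_iff ξ).1 h
  set Ψ := Submodule.span ℂ (Set.range fun p : ι × Dual ℂ H => contractSnd p.2 (ξ p.1)) with hΨ
  -- N is the common kernel of all the maps `toHom d H (ξ k)`; its codimension is dim Ψ ≤ s. The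
  -- maps factor through the quotient by N, where s vectors suffice.
  let N := Ψ.dualCoannihilator
  have hN : finrank ℂ (Hil d ⧸ N) ≤ s := by
    have e1 := Subspace.finrank_add_finrank_dualCoannihilator_eq Ψ
    have e2 := N.finrank_quotient_add_finrank
    change _ + finrank ℂ N = _ at e1
    omega
  obtain ⟨y, l, hyl⟩ := SchmidtNumber.exists_expansion hN
  choose x hx using fun i => N.mkQ_surjective (y i)
  have hker : ∀ k, ∀ v ∈ N, toHom d H (ξ k) v = 0 := by
    intro k v hv
    rw [← Module.forall_dual_apply_eq_zero_iff ℂ]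
    intro φ
    rw [Submodule.mem_dualCoannihilator] at hv
    exact hv _ (Submodule.subset_span ⟨(k, φ), rfl⟩)
  have hexp : ∀ k v, toHom d H (ξ k) v = ∑ i, l i (N.mkQ v) • toHom d H (ξ k) (x i) := by
    intro k v
    have hv : v - ∑ i, l i (N.mkQ v) • x i ∈ N := by
      rw [← Submodule.Quotient.mk_eq_zero, ← Submodule.mkQ_apply, map_sub, map_sum]
      simp_rw [map_smul, hx]
      exact sub_eq_zero.2 (hyl _)
    have := hker k _ hv
    rw [map_sub, sub_eq_zero] at this
    rw [this, map_sum]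
    simp_rw [map_smul]
  -- The vector u_i represents the functional l_i on the quotient through the bilinear form `dot`,
  -- and w_{k,i} is the value of the k-th map at the lift x_i.
  refine ⟨fun i => ∑ a, l i (N.mkQ (EuclideanSpace.single a 1)) • EuclideanSpace.single a 1,
    fun p => contractFst (x p.2) (ξ p.1), hR.mono ?_ h2, ?_⟩
  · rintro _ ⟨⟨k, i⟩, rfl⟩
    exact Submodule.subset_span ⟨(k, x i), rfl⟩
  · ext1 k
    conv_lhs => rw [sum_single_tmul_toHom (ξ k)]
    simp_rw [hexp k (EuclideanSpace.single _ 1), TensorProduct.tmul_sum, TensorProduct.sum_tmul,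
      TensorProduct.tmul_smul, ← TensorProduct.smul_tmul', contractFst_apply]
    exact Finset.sum_comm

/-! ### The maximal tensor product of two systems -/

/-- For scalar matrices whose rows are weighted sums of standard basis vectors, compression merely
picks entries of X. The witnesses α and Θ below have this form. -/
theorem conj_selection {V ι κ A : Type*} [AddCommGroup V] [Module ℂ V] [Fintype κ] [Fintype A]
    [DecidableEq κ] (c : ι → A → ℂ) (f : ι → A → κ) (X : Matrix κ κ V) (k l : ι) :
    conj (Matrix.of fun i p => ∑ a, if f i a = p then c i a else 0) X k l =
      ∑ a, ∑ b, (c k a * star (c l b)) • X (f k a) (f l b) := by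
  have hsel : ∀ (g : A → ℂ) (h : A → κ) (Y : κ → V),
      ∑ p, (∑ a, if h a = p then g a else 0) • Y p = ∑ a, g a • Y (h a) := by
    intro g h Y
    simp_rw [Finset.sum_smul, ite_smul, zero_smul]
    rw [Finset.sum_comm]
    simp
  simp_rw [conj_apply, Matrix.of_apply, mul_smul, ← Finset.smul_sum]
  rw [hsel]
  refine Finset.sum_congr rfl fun a _ => ?_
  congr 1
  simp_rw [star_sum, apply_ite star, star_zero]
  exact hsel (fun b => star (c l b)) (f l) _

theorem ite_zero_tmul_ite_zero {V W : Type*} [AddCommGroup V] [Module ℂ V] [AddCommGroup W]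
    [Module ℂ W] (p : Prop) [Decidable p] (x : V) (y : W) :
    (if p then x else 0) ⊗ₜ[ℂ] (if p then y else 0) = if p then x ⊗ₜ[ℂ] y else 0 := by
  split_ifs <;> simp

theorem IsSchmidtSystem.mem_maxCone {H M : Type} [AddCommGroup H] [Module ℂ H] [AddCommGroup M]
    [Module ℂ M] {B : H →ₗ[ℂ] H →ₛₗ[starRingEnd ℂ] M} {R : Set H → Prop} {T : MatrixOrder M}
    {d s : ℕ} {S : MatrixOrder (Mat d)}
    (hS : IsSchmidtSystem (ketBra d) (SpanRankLE d s) S) (hT : IsSchmidtSystem B R T)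
    {ι κ : Type} [Fintype ι] [Fintype κ] [Nonempty ι] [Nonempty κ] {P : Matrix ι ι (Mat d)}
    {Q : Matrix κ κ M} (hP : P ∈ gramCone (ketBra d) (SpanRankLE d s) ι)
    (hQ : Q ∈ gramCone B R κ) {n : ℕ} (α : Matrix (Fin n) (ι × κ) ℂ) :
    conj α (tmulMatrix P Q) ∈ S.maxCone T n := by
  let e := (Fintype.equivFin ι).symm
  let e' := (Fintype.equivFin κ).symm
  refine ⟨Fintype.card ι, Fintype.card κ, Fintype.card_pos, Fintype.card_pos, P.submatrix e e,
    (hS.pos_iff _ _).2 (hS.rank.submatrix_mem e hP), Q.submatrix e' e',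
    (hT.pos_iff _ _).2 (hT.rank.submatrix_mem e' hQ), α.submatrix id (e.prodCongr e'), ?_⟩
  rw [← conj_submatrix (e.prodCongr e')]
  rfl

/-- Conversely to tensoring Gram matrices, the expansion ξ_k = ∑_i u_i ⊗ w_{k,i} splits B(ξ_k, ξ_l)
into entries of P ⊗ Q, with P and Q the Gram matrices of u and w. -/
theorem IsSchmidtSystem.mem_maxCone_iff {H M : Type} [AddCommGroup H] [Module ℂ H]
    [AddCommGroup M] [Module ℂ M] {B : H →ₗ[ℂ] H →ₛₗ[starRingEnd ℂ] M} {R : Set H → Prop}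
    {T : MatrixOrder M} {d s : ℕ} (hs : 1 ≤ s) {S : MatrixOrder (Mat d)}
    (hS : IsSchmidtSystem (ketBra d) (SpanRankLE d s) S) (hT : IsSchmidtSystem B R T)
    (n : ℕ) (X : Matrix (Fin n) (Fin n) (Mat d ⊗[ℂ] M)) :
    X ∈ S.maxCone T n ↔
      X ∈ gramCone (TensorProduct.map₂ (ketBra d) B) (TensorRankCondition d s R) (Fin n) := by
  have hR := hT.rank.tensor d s
  constructor
  · rintro ⟨k, l, -, -, P, hP, Q, hQ, α, rfl⟩
    exact hR.conj_mem _ (hT.rank.tmul_mem ((hS.pos_iff _ _).1 hP) ((hT.pos_iff _ _).1 hQ))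
  · intro hX
    -- For n = 0 the index set of w is empty while the definition asks for positive sizes, so 1 × 1
    -- zero matrices are used.
    rcases Nat.eq_zero_or_pos n with rfl | hn
    · rw [Subsingleton.elim X (conj (0 : Matrix (Fin 0) (Fin 1 × Fin 1) ℂ) (tmulMatrix 0 0))]
      exact hS.mem_maxCone hT (zero_mem _) (zero_mem _) _
    obtain ⟨N, ξ, hN, hξ, rfl⟩ := hR.exists_sum hX
    choose u w hw hξw using fun t => TensorRankCondition.exists_expansion hT.rank (hξ t)
    have : Nonempty (Fin n) := ⟨⟨0, hn⟩⟩
    have : Nonempty (Fin N) := ⟨⟨0, hN⟩⟩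
    have : Nonempty (Fin s) := ⟨⟨0, hs⟩⟩
    convert hS.mem_maxCone hT
      (hS.rank.blockDiagonal_mem fun t => gramMatrix_mem (spanRankLE_range (u t)))
      (hT.rank.blockDiagonal_mem fun t => gramMatrix_mem (hw t))
      -- Row k is the sum of e_{(i,t)} ⊗ e_{((k,i),t)} over i and t. Using the same t in both
      -- factors makes the two block diagonals kill all terms with t ≠ t'.
      (Matrix.of fun (k : Fin n) p => ∑ a : Fin s × Fin N,
        if ((a.1, a.2), ((k, a.1), a.2)) = p then 1 else 0) using 1
    ext1 k l
    rw [conj_selection (fun _ _ => 1) fun (k : Fin n) (a : Fin s × Fin N) =>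
      ((a.1, a.2), ((k, a.1), a.2))]
    simp only [hξw, gramMatrix, Matrix.sum_apply, Matrix.of_apply, tmulMatrix_apply,
      Matrix.blockDiagonal_apply, Fintype.sum_prod_type, map_sum, LinearMap.sum_apply,
      TensorProduct.map₂_apply_tmul, TensorProduct.map_tmul, star_one, mul_one, one_smul]
    simp_rw [ite_zero_tmul_ite_zero, Finset.sum_ite_eq, Finset.mem_univ, if_true]
    rw [Finset.sum_comm (s := (Finset.univ : Finset (Fin s)))]
    exact Finset.sum_congr rfl fun t _ => Finset.sum_comm

theorem IsSchmidtSystem.maxTensor {H M : Type} [AddCommGroup H] [Module ℂ H] [AddCommGroup M]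
    [Module ℂ M] [FiniteDimensional ℂ H] [FiniteDimensional ℂ M]
    {B : H →ₗ[ℂ] H →ₛₗ[starRingEnd ℂ] M} {R : Set H → Prop} {T : MatrixOrder M}
    {d s : ℕ} (hs : 1 ≤ s) {S : MatrixOrder (Mat d)}
    (hS : IsSchmidtSystem (ketBra d) (SpanRankLE d s) S) (hT : IsSchmidtSystem B R T) :
    IsSchmidtSystem (TensorProduct.map₂ (ketBra d) B) (TensorRankCondition d s R)
      (S.maxTensor T) := by
  refine (hT.rank.tensor d s).archimedeanization (fun n => ?_) (hS.mem_maxCone_iff hs hT)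
  -- I_n ⊗ (1 ⊗ 1) is the tensor product of the 1 × 1 matrix [1] with I_n ⊗ 1, up to relabelling the
  -- indices.
  have := (hT.rank.tensor d s).conj_mem
    (Matrix.of fun (k : Fin n) (p : Fin 1 × Fin n) => if k = p.2 then 1 else 0)
    (hT.rank.tmul_mem (hS.unit_mem 1) (hT.unit_mem n))
  convert this using 1
  ext1 k l
  simp [conj_apply, tmulMatrix_apply, Fintype.sum_prod_type, Matrix.diagonal_apply,
    TensorProduct.tmul_ite, ite_smul, apply_ite (starRingEnd ℂ)]

/-! ### The set `Ω` -/

/-- The condition `SR ≤ (p, q, r)` on sets of tri-partite vectors. -/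
abbrev SchmidtRankLE₃ (a b c p q r : ℕ) : Set (Hil₃ a b c) → Prop :=
  TensorRankCondition a p (TensorRankCondition b q (SpanRankLE c r))

/-- The form `(ξ, η) ↦ |ξ⟩⟨η|` on tri-partite vectors. -/
abbrev ketBra₃ (a b c : ℕ) : Hil₃ a b c →ₗ[ℂ] Hil₃ a b c →ₛₗ[starRingEnd ℂ] Mat₃ a b c :=
  TensorProduct.map₂ (ketBra a) (TensorProduct.map₂ (ketBra b) (ketBra c))

/-- Three successive expansions write ξ_k in products u ⊗ v ⊗ x with p, q and r vectors, and the
coefficients form Θ. No limit is taken, so Ω is already the closed cone. -/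
theorem mem_omegaSet_iff {a b c p q r : ℕ} (ρ : Mat₃ a b c) :
    ρ ∈ omegaSet a b c p q r ↔
      oneByOne ρ ∈ gramCone (ketBra₃ a b c) (SchmidtRankLE₃ a b c p q r) (Fin 1) := by
  have hC := rankCondition_spanRankLE c r
  have hBC := hC.tensor b q
  have hABC := hBC.tensor a p
  constructor
  · rintro ⟨s, t, u, -, -, -, X, hX, Y, hY, Z, hZ, Θ, h⟩
    rw [h]
    exact hABC.conj_mem Θ (hBC.tmul_mem
      ((rankCondition_spanRankLE a p).blockDiagonal_mem fun i => mem_gramCone_of_mem_pos (hX i))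
      (hC.tmul_mem
        ((rankCondition_spanRankLE b q).blockDiagonal_mem fun i => mem_gramCone_of_mem_pos (hY i))
        (hC.blockDiagonal_mem fun i => mem_gramCone_of_mem_pos (hZ i))))
  · intro h
    obtain ⟨N, ξ, hN, hξ, hρ⟩ := hABC.exists_sum h
    choose u w hw hξw using fun t => TensorRankCondition.exists_expansion hBC (hξ t)
    choose v z hz hwz using fun t => TensorRankCondition.exists_expansion hC (hw t)
    choose x η hzx using fun t => exists_family_expansion (hz t)
    refine ⟨N, N, N, hN, hN, hN, fun t => gramMatrix (ketBra a) (u t),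
      fun t => gramMatrix_ketBra_mem_pos _ _ _, fun t => gramMatrix (ketBra b) (v t),
      fun t => gramMatrix_ketBra_mem_pos _ _ _, fun t => gramMatrix (ketBra c) (x t),
      fun t => gramMatrix_ketBra_mem_pos _ _ _,
      -- Θ is supported where the three block indices agree, so that only products from the same
      -- summand t contribute.
      Matrix.of fun (k : Fin 1) y => ∑ e : Fin N × Fin p × Fin q × Fin r,
        if ((e.2.1, e.1), ((e.2.2.1, e.1), (e.2.2.2, e.1))) = y then
          η e.1 ((k, e.2.1), e.2.2.1) e.2.2.2 else 0, ?_⟩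
    rw [hρ]
    ext1 k l
    rw [conj_selection (fun (k : Fin 1) (e : Fin N × Fin p × Fin q × Fin r) =>
      η e.1 ((k, e.2.1), e.2.2.1) e.2.2.2) fun (k : Fin 1) (e : Fin N × Fin p × Fin q × Fin r) =>
      ((e.2.1, e.1), ((e.2.2.1, e.1), (e.2.2.2, e.1)))]
    have hexp : ∀ t k, ξ t k = ∑ e : Fin p × Fin q × Fin r, η t ((k, e.1), e.2.1) e.2.2 •
        (u t e.1 ⊗ₜ[ℂ] (v t e.2.1 ⊗ₜ[ℂ] x t e.2.2)) := by
      intro t k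
      simp only [hξw, hwz, hzx, Fintype.sum_prod_type, TensorProduct.tmul_sum,
        TensorProduct.tmul_smul]
    simp only [Fintype.sum_prod_type (α₁ := Fin N), gramMatrix, Matrix.sum_apply, Matrix.of_apply,
      tmulMatrix_apply, Matrix.blockDiagonal_apply, ite_zero_tmul_ite_zero, smul_ite, smul_zero]
    refine Finset.sum_congr rfl fun t _ => ?_
    simp_rw [Finset.sum_comm (s := (Finset.univ : Finset (Fin N)))
      (t := (Finset.univ : Finset (Fin p × Fin q × Fin r)))]
    simp only [hexp, Finset.sum_ite_eq, Finset.mem_univ, if_true, map_sum, map_smul,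
      LinearMap.map_smulₛₗ, LinearMap.sum_apply, LinearMap.smul_apply, Finset.smul_sum,
      smul_smul,      TensorProduct.map₂_apply_tmul, TensorProduct.map_tmul, RCLike.star_def]
    rw [Finset.sum_comm]
    simp only [mul_comm]

/-! ### Positive elements as sums of projections -/

theorem oneByOne_mem_gramCone_iff {H M : Type} [AddCommGroup H] [Module ℂ H]
    [AddCommGroup M] [Module ℂ M] {B : H →ₗ[ℂ] H →ₛₗ[starRingEnd ℂ] M} {R : Set H → Prop}
    (hR : RankCondition B R) (ρ : M) : oneByOne ρ ∈ gramCone B R (Fin 1) ↔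
      ∃ (N : ℕ) (ξ : Fin N → H), (∀ i, R {ξ i}) ∧ ρ = ∑ i, B (ξ i) (ξ i) := by
  constructor
  · intro h
    obtain ⟨N, ξ, -, hξ, hρ⟩ := hR.exists_sum h
    refine ⟨N, fun t => ξ t 0, fun t => ?_, ?_⟩
    · simpa [Set.range_unique] using hξ t
    · simpa [oneByOne, gramMatrix, Matrix.sum_apply] using congrFun (congrFun hρ 0) 0
  · rintro ⟨N, ξ, hξ, rfl⟩
    have : oneByOne (∑ i, B (ξ i) (ξ i)) = ∑ i, gramMatrix B fun _ : Fin 1 => ξ i := by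
      ext k l
      simp [oneByOne, gramMatrix, Matrix.sum_apply]
    rw [this]
    exact sum_mem fun i _ => gramMatrix_mem (by simpa using hξ i)

/-! ### Schmidt ranks -/

/-- Both numbers are the codimension of the common kernel of the maps in K. The right side needs no
inner product and is visibly semicontinuous. -/
theorem finrank_biSup_orthogonal_ker {d : ℕ} {V : Type*} [AddCommGroup V] [Module ℂ V]
    (K : Set (Hil d →ₗ[ℂ] V)) :
    finrank ℂ ↥(⨆ T ∈ K, (LinearMap.ker T)ᗮ) = finrank ℂ (Submodule.span ℂ
      (Set.range fun p : K × Dual ℂ V => p.2 ∘ₗ p.1.1)) := by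
  set Ψ : Submodule ℂ (Dual ℂ (Hil d)) := Submodule.span ℂ
    (Set.range fun p : K × Dual ℂ V => p.2 ∘ₗ p.1.1)
  have h : (⨆ T ∈ K, (LinearMap.ker T)ᗮ)ᗮ = Ψ.dualCoannihilator := by
    ext x
    rw [iSup_subtype', ← Submodule.iInf_orthogonal]
    simp_rw [Submodule.orthogonal_orthogonal, Submodule.mem_iInf, Subtype.forall,
      LinearMap.mem_ker, Submodule.mem_dualCoannihilator]
    constructor
    · intro hx ψ hψ
      induction hψ using Submodule.span_induction with
      | mem ψ hψ =>
        obtain ⟨⟨T, φ⟩, rfl⟩ := hψ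
        simp [hx T T.2]
      | zero => rfl
      | add ψ ψ' _ _ h h' => simp [h, h']
      | smul z ψ _ h => simp [h]
    · intro hx T hT
      rw [← Module.forall_dual_apply_eq_zero_iff ℂ]
      intro φ
      exact hx _ (Submodule.subset_span ⟨(⟨T, hT⟩, φ), rfl⟩)
  have e1 := Subspace.finrank_add_finrank_dualCoannihilator_eq Ψ
  have e2 := (⨆ T ∈ K, (LinearMap.ker T)ᗮ).finrank_add_finrank_orthogonal
  rw [h] at e2
  change _ + finrank ℂ Ψ.dualCoannihilator = _ at e1
  exact Nat.add_right_cancel (e2.trans e1.symm)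

/-- This rewrites the condition in the recursive shape of the Schmidt rank: join of supports first,
then the set of values reached. -/
theorem tensorRankCondition_iff_finrank_biSup {d s : ℕ} {H : Type} [AddCommGroup H] [Module ℂ H]
    {R : Set H → Prop} (F : Set (Hil d ⊗[ℂ] H)) : TensorRankCondition d s R F ↔
      finrank ℂ ↥(⨆ T ∈ toHom d H '' F, (LinearMap.ker T)ᗮ) ≤ s ∧
        R (⋃ T ∈ toHom d H '' F, Set.range T) := by
  rw [finrank_biSup_orthogonal_ker, TensorRankCondition]
  have h1 : (Set.range fun p : toHom d H '' F × Dual ℂ H => p.2 ∘ₗ p.1.1) =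
      Set.range fun p : F × Dual ℂ H => contractSnd p.2 p.1.1 := by
    ext ψ
    constructor
    · rintro ⟨⟨⟨_, ⟨ξ, hξ, rfl⟩⟩, φ⟩, rfl⟩
      exact ⟨(⟨ξ, hξ⟩, φ), rfl⟩
    · rintro ⟨⟨⟨ξ, hξ⟩, φ⟩, rfl⟩
      exact ⟨(⟨_, ξ, hξ, rfl⟩, φ), rfl⟩
  have h2 : (⋃ T ∈ toHom d H '' F, Set.range T) =
      Set.range fun p : F × Hil d => contractFst p.2 p.1.1 := by
    ext w
    simp only [Set.mem_iUnion]
    constructor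
    · rintro ⟨_, ⟨ξ, hξ, rfl⟩, ⟨x, rfl⟩⟩
      exact ⟨(⟨ξ, hξ⟩, x), rfl⟩
    · rintro ⟨⟨⟨ξ, hξ⟩, x⟩, rfl⟩
      exact ⟨_, ⟨ξ, hξ, rfl⟩, ⟨x, rfl⟩⟩
  rw [h1, h2]

/-- Λ_ξ is `toHom` of ξ followed by an injective map, so the kernels agree. With a single map, the
join of supports is its support, whose dimension is the rank. -/
theorem schmidtRankLE₃_singleton_iff {a b c p q r : ℕ} (ξ : Hil₃ a b c) :
    SchmidtRankLE₃ a b c p q r {ξ} ↔ rankA ξ ≤ p ∧ rankB ξ ≤ q ∧ rankC ξ ≤ r := by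
  set T₀ := toHom a (Hil b ⊗[ℂ] Hil c) ξ with hT₀
  have hassoc : assocMap₃ ξ = toHom b (Hil c) ∘ₗ T₀ := toHom_map _ ξ
  have hker : LinearMap.ker (assocMap₃ ξ) = LinearMap.ker T₀ := by
    rw [hassoc]
    exact LinearMap.ker_comp_of_ker_eq_bot _ (LinearMap.ker_eq_bot.2 toHom_injective)
  have hA : rankA ξ = finrank ℂ (LinearMap.ker T₀)ᗮ := by
    have e1 := LinearMap.finrank_range_add_finrank_ker (assocMap₃ ξ)
    have e2 := (LinearMap.ker T₀).finrank_add_finrank_orthogonal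
    rw [hker] at e1
    rw [rankA]
    omega
  have hrange : (toHom b (Hil c) '' ⋃ T ∈ ({T₀} : Set (Hil a →ₗ[ℂ] Hil b ⊗[ℂ] Hil c)),
      Set.range T) = (LinearMap.range (assocMap₃ ξ) : Set (Hil b →ₗ[ℂ] Hil c)) := by
    rw [Set.biUnion_singleton, hassoc, LinearMap.coe_range, LinearMap.coe_comp, Set.range_comp]
  have hC : Submodule.span ℂ (⋃ T ∈ (LinearMap.range (assocMap₃ ξ) : Set (Hil b →ₗ[ℂ] Hil c)),
      Set.range T) = ⨆ T ∈ LinearMap.range (assocMap₃ ξ), LinearMap.range T := by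
    rw [Submodule.span_iUnion₂]
    refine iSup_congr fun T => iSup_congr fun _ => ?_
    rw [← LinearMap.coe_range, Submodule.span_eq]
  rw [SchmidtRankLE₃, tensorRankCondition_iff_finrank_biSup,
    tensorRankCondition_iff_finrank_biSup, Set.image_singleton, ← hT₀, hrange, SpanRankLE, hC,
    iSup_singleton, hA]
  rfl

theorem isSchmidtSystem_omaxTensor₃ (a b c : ℕ) {p q r : ℕ} (hp : 1 ≤ p) (hq : 1 ≤ q)
    (hr : 1 ≤ r) : IsSchmidtSystem (ketBra₃ a b c) (SchmidtRankLE₃ a b c p q r)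
      (omaxTensor₃ a b c p q r) :=
  (isSchmidtSystem_omax a hp).maxTensor hp
    ((isSchmidtSystem_omax b hq).maxTensor hq (isSchmidtSystem_omax c hr))

/-! ### Many parties -/

/-- The condition `SR ≤ (s_0, …, s_n)` on sets of multi-partite vectors. -/
def SchmidtRankLEN : (n : ℕ) → (d s : Fin (n + 1) → ℕ) → Set (HilN n d) → Prop
  | 0, d, s => SpanRankLE (d 0) (s 0)
  | n + 1, d, s =>
      TensorRankCondition (d 0) (s 0) (SchmidtRankLEN n (Fin.tail d) (Fin.tail s))

theorem finiteDimensional_hilN : (n : ℕ) → (d : Fin (n + 1) → ℕ) → FiniteDimensional ℂ (HilN n d)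
  | 0, d => inferInstanceAs (FiniteDimensional ℂ (Hil (d 0)))
  | n + 1, d =>
      have := finiteDimensional_hilN n (Fin.tail d)
      inferInstanceAs (FiniteDimensional ℂ (Hil (d 0) ⊗[ℂ] HilN n (Fin.tail d)))

theorem finiteDimensional_matN : (n : ℕ) → (d : Fin (n + 1) → ℕ) → FiniteDimensional ℂ (MatN n d)
  | 0, d => inferInstanceAs (FiniteDimensional ℂ (Mat (d 0)))
  | n + 1, d =>
      have := finiteDimensional_matN n (Fin.tail d)
      inferInstanceAs (FiniteDimensional ℂ (Mat (d 0) ⊗[ℂ] MatN n (Fin.tail d)))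

theorem isSchmidtSystem_omaxTensorN : (n : ℕ) → (d s : Fin (n + 1) → ℕ) → (∀ i, 1 ≤ s i) →
    IsSchmidtSystem (ketBraN n d) (SchmidtRankLEN n d s) (omaxTensorN n d s)
  | 0, d, _, hs => isSchmidtSystem_omax (d 0) (hs 0)
  | n + 1, d, s, hs =>
      have := finiteDimensional_hilN n (Fin.tail d)
      have := finiteDimensional_matN n (Fin.tail d)
      (isSchmidtSystem_omax (d 0) (hs 0)).maxTensor (hs 0)
        (isSchmidtSystem_omaxTensorN n (Fin.tail d) (Fin.tail s) fun i => hs i.succ)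

theorem assocMapN_succ_apply (n : ℕ) (d : Fin (n + 2) → ℕ)
    (ξ : Hil (d 0) ⊗[ℂ] HilN n (Fin.tail d)) :
    (assocMapN (n + 1) d ξ : Hil (d 0) →ₗ[ℂ] HomN n (Fin.tail d)) =
      assocMapN n (Fin.tail d) ∘ₗ toHom (d 0) (HilN n (Fin.tail d)) ξ :=
  toHom_map (assocMapN n (Fin.tail d)) ξ

theorem assocMapN_injective : (n : ℕ) → (d : Fin (n + 1) → ℕ) →
    Function.Injective (assocMapN n d)
  | 0, _ => fun _ _ h => h
  | n + 1, d => fun ξ η h => by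
      refine toHom_injective (d := d 0) (W := HilN n (Fin.tail d)) (LinearMap.ext fun x => ?_)
      apply assocMapN_injective n (Fin.tail d)
      have h' := (assocMapN_succ_apply n d ξ).symm.trans (h.trans (assocMapN_succ_apply n d η))
      exact LinearMap.congr_fun h' x

/-- Composition with the injective `assocMapN` preserves kernels and carries the values reached to
their image. The statement concerns sets F because the induction passes from F to these values. -/
theorem schmidtRankLEN_iff : (n : ℕ) → (d s : Fin (n + 1) → ℕ) → (F : Set (HilN n d)) →
    (SchmidtRankLEN n d s F ↔ ∀ j, joinRanks n d (assocMapN n d '' F) j ≤ s j)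
  | 0, d, s, F => by
      have himg : assocMapN 0 d '' F = F := Set.image_id F
      rw [himg, Fin.forall_fin_one]
      rfl
  | n + 1, d, s, F => by
      let G : Set (Hil (d 0) →ₗ[ℂ] HilN n (Fin.tail d)) :=
        toHom (d 0) (HilN n (Fin.tail d)) '' F
      let K : Set (Hil (d 0) →ₗ[ℂ] HomN n (Fin.tail d)) := assocMapN (n + 1) d '' F
      have hK : K = (fun T => assocMapN n (Fin.tail d) ∘ₗ T) '' G := by
        refine Eq.trans ?_ (Set.image_image _ (toHom (d 0) (HilN n (Fin.tail d))) F).symm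
        exact Set.image_congr fun ξ _ => assocMapN_succ_apply n d ξ
      have hsup : (⨆ T ∈ K, (LinearMap.ker T)ᗮ) = ⨆ T ∈ G, (LinearMap.ker T)ᗮ := by
        rw [hK, iSup_image]
        refine iSup_congr fun T => iSup_congr fun _ => ?_
        rw [LinearMap.ker_comp_of_ker_eq_bot _
          (LinearMap.ker_eq_bot.2 (assocMapN_injective n (Fin.tail d)))]
      have hunion : (⋃ T ∈ K, Set.range T) =
          assocMapN n (Fin.tail d) '' ⋃ T ∈ G, Set.range T := by
        rw [hK, Set.biUnion_image, Set.image_iUnion₂]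
        refine Set.iUnion₂_congr fun T _ => ?_
        rw [LinearMap.coe_comp, Set.range_comp]
      have hrank : joinRanks (n + 1) d (assocMapN (n + 1) d '' F) =
          Fin.cons (α := fun _ => ℕ) (finrank ℂ ↥(⨆ T ∈ K, (LinearMap.ker T)ᗮ))
            (joinRanks n (Fin.tail d) (⋃ T ∈ K, Set.range T)) := rfl
      rw [hrank, Fin.forall_fin_succ, hsup, hunion]
      simp only [Fin.cons_zero, Fin.cons_succ]
      refine (tensorRankCondition_iff_finrank_biSup F).trans (and_congr_right fun _ => ?_)
      exact schmidtRankLEN_iff n (Fin.tail d) (Fin.tail s) _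

theorem schmidtRankLEN_singleton_iff (n : ℕ) (d s : Fin (n + 1) → ℕ) (ξ : HilN n d) :
    SchmidtRankLEN n d s {ξ} ↔ ∀ j, schmidtRankN n d ξ j ≤ s j := by
  rw [schmidtRankLEN_iff, Set.image_singleton]
  rfl

end SchmidtNumber

end

theorem mainTheorem2 :
    (∀ a b c p q r : ℕ, 1 ≤ p → 1 ≤ q → 1 ≤ r →
      (∀ ρ : SchmidtNumber.Mat₃ a b c,
        ρ ∈ SchmidtNumber.schmidtCone₃ a b c p q r ↔
          ρ ∈ (SchmidtNumber.omaxTensor₃ a b c p q r).posCone) ∧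
      SchmidtNumber.omegaSet a b c p q r =
        (SchmidtNumber.omaxTensor₃ a b c p q r).posCone) ∧
    (∀ (n : ℕ) (d s : Fin (n + 1) → ℕ), (∀ i, 1 ≤ s i) →
      SchmidtNumber.schmidtConeN n d s = (SchmidtNumber.omaxTensorN n d s).posCone) := by
  refine ⟨fun a b c p q r hp hq hr => ?_, fun n d s hs => ?_⟩
  · have h := SchmidtNumber.isSchmidtSystem_omaxTensor₃ a b c hp hq hr
    refine ⟨fun ρ => Iff.trans ?_ (h.pos_iff 1 _).symm, Set.ext fun ρ => ?_⟩
    · rw [SchmidtNumber.oneByOne_mem_gramCone_iff h.rank]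
      simp only [SchmidtNumber.schmidtRankLE₃_singleton_iff]
      rfl
    · exact (SchmidtNumber.mem_omegaSet_iff ρ).trans (h.pos_iff 1 _).symm
  · have h := SchmidtNumber.isSchmidtSystem_omaxTensorN n d s hs
    refine Set.ext fun ρ => Iff.trans ?_ (h.pos_iff 1 _).symm
    rw [SchmidtNumber.oneByOne_mem_gramCone_iff h.rank]
    simp only [SchmidtNumber.schmidtRankLEN_singleton_iff]
    rfl
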